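/- Let $T$ be a triangle in the plane with vertices $A,B,C$ and $|CA|=|CB|$, whose base angle at $A$ (equivalently at $B$) is either an irrational multiple of $\pi$ or equal to $\frac ab\pi$ with $a/b$ a fraction in lowest terms and $b$ even. Let $M$ be the midpoint of the base $AB$, let $T'=MBC$ be the right triangle that is one half of $T$, and let $\mathrm{fold}\colon T\to T'$ be the identity on $T'$ and the reflection across the line $CM$ on the other half of $T$. A periodic billiard trajectory on a triangle is a map $f$ from $\mathbb R$ to the triangle, with a chosen period $L>0$ (so $f(t+L)=f(t)$; $L$ need not be minimal), that never meets a vertex, moves along straight lines with unit speed off the edges, and has its velocity reflected across an edge whenever it strikes that edge. Its combinatorial type is the finite sequence of edges struck during one period $[0,L)$, in order of time; two combinatorial types are regarded as the same if one is obtained from the other by a cyclic permutation (change of the starting point on the closed trajectory), possibly combined with reversal. For a periodic trajectory $f$ on $T$ with period $L$, the induced trajectory on $T'$ is $f'=\mathrm{fold}\circ f$, with the same period $L$; its combinatorial type with respect to the edges $MB$, $BC$, $CM$ of $T'$ is defined provided that $f'$ does not meet the vertex $M$ of $T'$, i.e. $f$ does not pass through $M$. Let $f$ and $g$ be periodic billiard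 trajectories on $T$. If the induced trajectories $f'$ and $g'$ on $T'$ have the same combinatorial type (in particular, neither $f$ nor $g$ passes through $M$), then $f$ and $g$ have the same combinatorial type. -/

import Mathlib

/-- The `i`-th (closed) edge of the triangle with vertices `v 0, v 1, v 2`:
the segment from `v i` to `v (i + 1)`, indices mod `3`. -/
def edge (v : Fin 3 → ℂ) (i : Fin 3) : Set ℂ :=
  segment ℝ (v i) (v (i + 1))

/-- The linear part of the reflection of the plane across the line through the `i`-th edge. -/
noncomputable def edgeReflection (v : Fin 3 → ℂ) (i : Fin 3) : ℂ → ℂ :=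
  fun u => Submodule.reflection (Submodule.span ℝ {v (i + 1) - v i}) u

/-- `f` is a unit speed billiard trajectory on the triangle `v` that closes up after time `L`
(`L` is a period, not necessarily the smallest one).  It never meets a vertex, it moves in a straight
line off the edges, and its velocity is reflected across an edge whenever it strikes that edge. -/
structure IsPeriodicTrajectory (v : Fin 3 → ℂ) (f : ℝ → ℂ) (L : ℝ) : Prop where
  pos : 0 < L
  periodic : Function.Periodic f L
  mem : ∀ t, f t ∈ convexHull ℝ (Set.range v)
  ne_vertex : ∀ t i, f t ≠ v i
  straight : ∀ t, (∀ i, f t ∉ edge v i) →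
    ∃ u : ℂ, ‖u‖ = 1 ∧ ∀ᶠ s in nhds t, f s = f t + (s - t) • u
  reflect : ∀ t i, f t ∈ edge v i →
    ∃ u : ℂ, ‖u‖ = 1 ∧
      (∀ᶠ s in nhdsWithin t (Set.Iic t), f s = f t + (s - t) • u) ∧
      (∀ᶠ s in nhdsWithin t (Set.Ici t), f s = f t + (s - t) • edgeReflection v i u)

/-- The word `w` lists, in order of time, the edges of the triangle `v` struck by `f` during one
period `[0, L)`.  Every struck point has to lie on exactly one edge: a path that runs into a vertex
has no combinatorial type. -/
def HasCombinatorialType (v : Fin 3 → ℂ) (f : ℝ → ℂ) (L : ℝ) (w : List (Fin 3)) : Prop :=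
  ∃ τ : Fin w.length → ℝ, StrictMono τ ∧
    Set.range τ = {t | t ∈ Set.Ico 0 L ∧ ∃ i, f t ∈ edge v i} ∧
    ∀ j i, f (τ j) ∈ edge v i ↔ i = w.get j

/-- `f` (over the period `L`) and `g` (over the period `M`) both have a combinatorial type on the
triangle `v`, and the two types agree up to the choice of the starting point on the closed
trajectory (cyclic permutation) and up to reversal. -/
def SameCombinatorialType (v : Fin 3 → ℂ) (f : ℝ → ℂ) (L : ℝ) (g : ℝ → ℂ) (M : ℝ) : Prop :=
  ∃ w w' : List (Fin 3), HasCombinatorialType v f L w ∧ HasCombinatorialType v g M w' ∧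
    (w.IsRotated w' ∨ w.IsRotated w'.reverse)

/-- The triangle `T` with base `A B` (edge `0`) and apex `C`; edge `1` is `B C`, edge `2` is
`C A`. -/
def triangleT (A B C : ℂ) : Fin 3 → ℂ := ![A, B, C]

/-- The right triangle `T'`, the half of `T` that contains `B`: edge `0` is the half `M B` of the
base, edge `1` is the hypotenuse `B C`, edge `2` is the altitude `C M`, with `M` the midpoint of
`A B`. -/
noncomputable def triangleT' (A B C : ℂ) : Fin 3 → ℂ := ![midpoint ℝ A B, B, C]

instance perpBisectorNonempty (A B : ℂ) : Nonempty (AffineSubspace.perpBisector A B) :=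
  ⟨⟨midpoint ℝ A B, AffineSubspace.midpoint_mem_perpBisector A B⟩⟩

open Classical in
/-- Folding of the plane along the perpendicular bisector of `A B` (the symmetry axis of `T`): points
on the side of `A` are reflected across the axis, the others stay where they are. -/
noncomputable def fold (A B : ℂ) (z : ℂ) : ℂ :=
  if dist z A < dist z B then
    EuclideanGeometry.reflection (AffineSubspace.perpBisector A B) z
  else z

/-- The angle `β` is an irrational multiple of `π`, or `(a / b) π` with `a / b` in lowest terms and
`b` even. -/
def AngleCondition (β : ℝ) : Prop :=
  Irrational (β / Real.pi) ∨ ∃ q : ℚ, β = q * Real.pi ∧ Even q.den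

/-!
A trajectory whose folding strikes the altitude `C M` of the half triangle is one that crosses the
axis of the isosceles triangle. The word of `fold ∘ f` therefore determines the word of `f` once it is
known on which side of the axis `f` starts (`unfoldWord`), and the other choice of the side exchanges
the two legs in the word. Hence it is enough to prove that the word of a trajectory that avoids the
midpoint `M` of the base does not change, up to rotation and reversal, when the legs are exchanged
(`IsNormalisation.map_swapLegs_isRotated`).

A similarity turns the triangle into `-1`, `1`, `c i` with base angle `β`; let `ζ = exp (2 i β)`.
Reflecting in the base turns the trajectory into one in the rhombus with vertices `±1`, `±c i`, and
unfolding at the legs gives a straight path through copies of the rhombus, numbered by the integers: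
a hit of a leg leads to the next or to the previous copy, and the direction of the trajectory in the
`k`-th copy is `ζ ^ k` times its direction in a fixed one. Opposite edges of the rhombus are
identified by the half turn about its centre, which is `M`. Let `m` be the order of `ζ ^ 2`, or `0` if
it is infinite: copies whose numbers agree modulo `m` carry parallel chords. The angle condition says
that `m = 0` or `ζ ^ m = -1`. These data form a `ChordSystem`, and the symmetry is read off from it.

A chord in a copy extends to an affine map between two edges that carries the hits of the
trajectory to hits. The chords of a copy match up the hits on its edges, so that all edge classes have
hits of the same parity (`ChordSystem.even_card_hits_iff`). A chord that joins adjacent edges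
cuts off a vertex and preserves the parity of the rank of a hit in its class. A chord that joins
opposite edges changes this parity: after the identification its ends lie in one class, symmetrically
to a point that is not a hit because no chord passes through `M`, and the hits between the ends are
paired off by the symmetry. It follows that neighbouring hits of an edge class pass it in opposite
directions (`ChordSystem.exists_dir_eq_rank`).

If the number of hits of the classes is even, then every hit has a neighbour on its class such that no
hit, and no vertex, comes into the strip between the two as it follows the trajectory, and the
neighbour runs through the trajectory backwards. This gives a symmetry that reverses the time
(`ChordSystem.exists_reversal`). It maps to itself a chord that joins opposite edges, that is, a
piece of the trajectory that runs from one leg to the base and on to the other leg; hence the symmetry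
exchanges the legs.

If the number is odd, then each class is passed once more in one direction than in the other
before the data repeat, so that the trajectory has then advanced by exactly `m` copies
(`ChordSystem.exists_winding`); in particular `m ≠ 0`. Its direction has been multiplied by
`ζ ^ m = -1`, and so it meets the same points on the opposite legs: a shift in time exchanges the legs.
This is the only place where the evenness of the denominator matters.
-/

/-! ### Chords of a rhombus -/

/-- The value at a boundary point of the rhombus with vertices `±1`, `±i` of the linear functional
with `1 ↦ α` and `i ↦ γ`.  The point has parameter `x`, and lies on the edge from `1` to `i` if
`d = 1`, on the edge from `-1` to `i` if `d = -1`. -/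
def edgeValue (α γ : ℝ) (d : ℤˣ) (x : ℝ) : ℝ := ((d : ℤ) : ℝ) * α * (1 - x) + γ * x

/-- A line that is not an edge meets the boundary of the rhombus in at most two points. -/
theorem chord_unique {α γ : ℝ} (h : α ≠ 0 ∨ γ ≠ 0) {d d₁ d₂ r₁ r₂ : ℤˣ} {x x₁ x₂ : ℝ}
    (hx : x ∈ Set.Ioo (0 : ℝ) 1) (hx₁ : x₁ ∈ Set.Ioo (0 : ℝ) 1) (hx₂ : x₂ ∈ Set.Ioo (0 : ℝ) 1)
    (t₁ : d₁ = d → r₁ = -1) (t₂ : d₂ = d → r₂ = -1)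
    (e₁ : edgeValue α γ d x = ((r₁ : ℤ) : ℝ) * edgeValue α γ d₁ x₁)
    (e₂ : edgeValue α γ d x = ((r₂ : ℤ) : ℝ) * edgeValue α γ d₂ x₂) :
    r₁ = r₂ ∧ d₁ = d₂ ∧ x₁ = x₂ := by
  have det0 : ∀ {p q p' q' : ℝ}, α * p + γ * q = 0 → α * p' + γ * q' = 0 → p * q' - p' * q = 0 := by
    intro p q p' q' h1 h2
    rcases h with h | h
    · apply mul_left_cancel₀ h; linear_combination q' * h1 - q * h2
    · apply mul_left_cancel₀ h; linear_combination p * h2 - p' * h1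
  obtain ⟨hx, hx'⟩ := hx
  obtain ⟨hx₁, hx₁'⟩ := hx₁
  obtain ⟨hx₂, hx₂'⟩ := hx₂
  wlog hd : d = 1 generalizing α d d₁ d₂
  · have hd : d = -1 := (Int.units_eq_one_or d).resolve_left hd
    subst hd
    have := this (α := -α) (d := 1) (d₁ := -d₁) (d₂ := -d₂) (by simpa using h)
      (by intro h; exact t₁ (by rw [← h, neg_neg])) (by intro h; exact t₂ (by rw [← h, neg_neg]))
      (by simp only [edgeValue] at e₁ ⊢; push_cast at e₁ ⊢; linarith)
      (by simp only [edgeValue] at e₂ ⊢; push_cast at e₂ ⊢; linarith)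
      (by
        intro p q p' q' h1 h2
        have := det0 (p := -p) (p' := -p') (q := q) (q' := q') (by linarith) (by linarith)
        linarith) rfl
    exact ⟨this.1, neg_injective this.2.1, this.2.2⟩
  subst hd
  rcases Int.units_eq_one_or d₁ with rfl | rfl <;> rcases Int.units_eq_one_or d₂ with rfl | rfl <;>
  rcases Int.units_eq_one_or r₁ with rfl | rfl <;> rcases Int.units_eq_one_or r₂ with rfl | rfl <;>
  simp only [edgeValue] at e₁ e₂ <;> push_cast at e₁ e₂ <;>
  first
  | exact absurd (t₁ rfl) (by decide)
  | exact absurd (t₂ rfl) (by decide)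
  | (refine ⟨rfl, rfl, ?_⟩
     first
     | (have h0 := det0 (p := x₁ - x) (q := x + x₁) (p' := x₂ - x) (q' := x + x₂)
          (by linarith) (by linarith)
        have : 2 * x * (x₁ - x₂) = 0 := by linarith
        have := (mul_eq_zero.1 this).resolve_left (by positivity)
        linarith)
     | (have h0 := det0 (p := 2 - x - x₁) (q := x - x₁) (p' := 2 - x - x₂) (q' := x - x₂)
          (by linarith) (by linarith)
        have : 2 * (1 - x) * (x₁ - x₂) = 0 := by linarith
        have := (mul_eq_zero.1 this).resolve_left (by nlinarith)
        linarith)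
     | (have h0 := det0 (p := 2 - x - x₁) (q := x + x₁) (p' := 2 - x - x₂) (q' := x + x₂)
          (by linarith) (by linarith)
        linarith))
  | (exfalso
     have key : ∀ {y z : ℝ}, 0 < y → y < 1 → 0 < z → z < 1 →
         α * (y - x) + γ * (x + y) = 0 → α * (2 - x - z) + γ * (x - z) = 0 → False := by
       intro y z hy hy' hz hz' h1 h2
       have := det0 h1 h2
       nlinarith [mul_pos hy (sub_pos.2 hz'), mul_pos hx (sub_pos.2 hz'), mul_pos hx (sub_pos.2 hy'),
         mul_pos hx (sub_pos.2 hx'), mul_pos hy (sub_pos.2 hx'), mul_pos hy hz]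
     have key2 : ∀ {y z : ℝ}, 0 < y → y < 1 → 0 < z → z < 1 →
         α * (y - x) + γ * (x + y) = 0 → α * (2 - x - z) + γ * (x + z) = 0 → False := by
       intro y z hy hy' hz hz' h1 h2
       have := det0 h1 h2
       nlinarith [mul_pos hy (sub_pos.2 hz'), mul_pos hx (sub_pos.2 hy')]
     have key3 : ∀ {y z : ℝ}, 0 < y → y < 1 → 0 < z → z < 1 →
         α * (2 - x - y) + γ * (x - y) = 0 → α * (2 - x - z) + γ * (x + z) = 0 → False := by
       intro y z hy hy' hz hz' h1 h2
       have := det0 h1 h2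
       nlinarith [mul_pos hz (sub_pos.2 hx'), mul_pos (sub_pos.2 hx') hy,
         mul_pos hy (sub_pos.2 hz'), mul_pos (sub_pos.2 hy') hz]
     first
     | exact key hx₁ hx₁' hx₂ hx₂' (by linarith) (by linarith)
     | exact key hx₂ hx₂' hx₁ hx₁' (by linarith) (by linarith)
     | exact key2 hx₁ hx₁' hx₂ hx₂' (by linarith) (by linarith)
     | exact key2 hx₂ hx₂' hx₁ hx₁' (by linarith) (by linarith)
     | exact key3 hx₁ hx₁' hx₂ hx₂' (by linarith) (by linarith)
     | exact key3 hx₂ hx₂' hx₁ hx₁' (by linarith) (by linarith))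

/-- The chords parallel to a given one match two edges of the rhombus by an affine map.  It is
increasing (for parameters measured from the vertices `1`, `-1` towards `±i`) when the chord cuts
off a vertex, and decreasing when it joins two opposite edges. -/
theorem exists_affine_of_chord {α γ : ℝ} {d d' r : ℤˣ} {x x' : ℝ}
    (hx : x ∈ Set.Ioo (0 : ℝ) 1) (hx' : x' ∈ Set.Ioo (0 : ℝ) 1) (t : d' = d → r = -1)
    (e : edgeValue α γ d x = ((r : ℤ) : ℝ) * edgeValue α γ d' x') :
    ∃ q : ℝ, q ≠ 0 ∧ (0 < q ↔ d' ≠ d) ∧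
      (∀ z, edgeValue α γ d z = ((r : ℤ) : ℝ) * edgeValue α γ d' (x' + q * (z - x))) ∧
      ((q = -1 ∧ d' = d) ∨ (q = x' / x) ∨ (q = (1 - x') / (1 - x))) := by
  obtain ⟨hx, hx1⟩ := hx
  obtain ⟨hx', hx1'⟩ := hx'
  have hx2 : 0 < 1 - x := by linarith
  have hx2' : 0 < 1 - x' := by linarith
  by_cases hd : d' = d
  · obtain rfl := t hd
    subst hd
    refine ⟨-1, by norm_num, by norm_num, fun z => ?_, Or.inl ⟨rfl, rfl⟩⟩
    simp only [edgeValue] at *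
    push_cast at *
    linarith
  · have hd' : d' = -d := by
      rcases Int.units_eq_one_or d with rfl | rfl <;> rcases Int.units_eq_one_or d' with rfl | rfl <;>
        simp_all
    subst hd'
    rcases Int.units_eq_one_or r with rfl | rfl
    · have hq : 0 < (1 - x') / (1 - x) := by positivity
      refine ⟨_, hq.ne', by simp [hd, hq], fun z => ?_, Or.inr (Or.inr rfl)⟩
      simp only [edgeValue] at *
      push_cast at *
      field_simp
      linear_combination (1 - z) * e
    · have hq : 0 < x' / x := by positivity
      refine ⟨_, hq.ne', by simp [hd, hq], fun z => ?_, Or.inr (Or.inl rfl)⟩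
      simp only [edgeValue] at *
      push_cast at *
      field_simp
      linear_combination z * e

/-! ### Ranks in a finite set of reals -/

/-- The number of elements of `s` to the left of `x`. -/
noncomputable def rankIn (s : Finset ℝ) (x : ℝ) : ℕ := (s.filter (· < x)).card

theorem rankIn_add_card_gt {s : Finset ℝ} {x : ℝ} (hx : x ∈ s) :
    rankIn s x + (s.filter (x < ·)).card + 1 = s.card := by
  have h1 : s = insert x (s.filter (· < x) ∪ s.filter (x < ·)) := by
    ext y
    simp only [Finset.mem_insert, Finset.mem_union, Finset.mem_filter]
    constructor
    · intro hy
      rcases lt_trichotomy y x with h | h | h <;> simp [h, hy]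
    · rintro (rfl | h | h)
      exacts [hx, h.1, h.1]
  have h2 : Disjoint (s.filter (· < x)) (s.filter (x < ·)) := by
    rw [Finset.disjoint_filter]
    intro y _ h h'
    exact lt_asymm h h'
  conv_rhs => rw [h1]
  rw [Finset.card_insert_of_notMem (by simp), Finset.card_union_of_disjoint h2]
  rfl

theorem rankIn_between {s : Finset ℝ} {x y : ℝ} (hx : x ∈ s) (hxy : x < y) :
    rankIn s y = rankIn s x + (s.filter (fun z => x < z ∧ z < y)).card + 1 := by
  have h1 : s.filter (· < y) = insert x (s.filter (· < x) ∪ s.filter (fun z => x < z ∧ z < y)) := by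
    ext z
    simp only [Finset.mem_insert, Finset.mem_union, Finset.mem_filter]
    constructor
    · rintro ⟨hz, hzy⟩
      rcases lt_trichotomy z x with h | h | h <;> simp [h, hz, hzy]
    · rintro (rfl | h | h)
      exacts [⟨hx, hxy⟩, ⟨h.1, h.2.trans hxy⟩, ⟨h.1, h.2.2⟩]
  have h2 : Disjoint (s.filter (· < x)) (s.filter (fun z => x < z ∧ z < y)) := by
    rw [Finset.disjoint_filter]
    intro y _ h h'
    exact lt_asymm h h'.1
  rw [rankIn, h1, Finset.card_insert_of_notMem (by simp), Finset.card_union_of_disjoint h2]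
  rfl

theorem exists_next_of_even_rankIn {s : Finset ℝ} {x : ℝ} (hx : x ∈ s) (hs : Even s.card)
    (hr : Even (rankIn s x)) : ∃ y ∈ s, x < y ∧ ∀ z ∈ s, ¬ (x < z ∧ z < y) := by
  have h := rankIn_add_card_gt hx
  have hne : (s.filter (x < ·)).Nonempty := by
    rw [Finset.nonempty_iff_ne_empty]
    intro h0
    rw [h0, Finset.card_empty] at h
    rw [← h] at hs
    exact (Nat.not_even_iff_odd.2 (hr.add_one)) hs
  obtain ⟨y, hy, hmin⟩ := (s.filter (x < ·)).exists_min_image id hne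
  rw [Finset.mem_filter] at hy
  refine ⟨y, hy.1, hy.2, fun z hz hzz => ?_⟩
  exact absurd (hmin z (Finset.mem_filter.2 ⟨hz, hzz.1⟩)) (not_le.2 hzz.2)

theorem exists_prev_of_odd_rankIn {s : Finset ℝ} {x : ℝ}
    (hr : ¬ Even (rankIn s x)) : ∃ y ∈ s, y < x ∧ ∀ z ∈ s, ¬ (y < z ∧ z < x) := by
  have hne : (s.filter (· < x)).Nonempty := by
    rw [Finset.nonempty_iff_ne_empty]
    intro h0
    rw [rankIn, h0] at hr
    simp at hr
  obtain ⟨y, hy, hmax⟩ := (s.filter (· < x)).exists_max_image id hne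
  rw [Finset.mem_filter] at hy
  refine ⟨y, hy.1, hy.2, fun z hz hzz => ?_⟩
  exact absurd (hmax z (Finset.mem_filter.2 ⟨hz, hzz.2⟩)) (not_le.2 hzz.1)

theorem rankIn_succ {s : Finset ℝ} {x y : ℝ} (hx : x ∈ s) (hxy : x < y)
    (h : ∀ z ∈ s, ¬ (x < z ∧ z < y)) : rankIn s y = rankIn s x + 1 := by
  rw [rankIn_between hx hxy, Finset.filter_false_of_mem h, Finset.card_empty]

theorem sum_neg_one_pow_rankIn (s : Finset ℝ) :
    ∑ x ∈ s, (-1 : ℤ) ^ rankIn s x = if Even s.card then 0 else 1 := by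
  induction s using Finset.induction_on_max with
  | empty => simp
  | insert a s ha ih =>
    have has : a ∉ s := fun h => lt_irrefl _ (ha a h)
    have h1 : rankIn (insert a s) a = s.card := by
      rw [rankIn, Finset.filter_insert, if_neg (lt_irrefl a), Finset.filter_true_of_mem ha]
    have h2 : ∀ x ∈ s, rankIn (insert a s) x = rankIn s x := by
      intro x hx
      rw [rankIn, Finset.filter_insert, if_neg (ha x hx).not_gt]
      rfl
    rw [Finset.sum_insert has, h1, Finset.sum_congr rfl fun x hx => by rw [h2 x hx], ih,
      Finset.card_insert_of_notMem has]
    by_cases h : Even s.card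
    · simp [h, h.neg_one_pow, Nat.even_add_one]
    · simp [h, (Nat.not_even_iff_odd.1 h).neg_one_pow, Nat.even_add_one]

/-- A finite set on which a relation restricts to a perfect matching has an even number of
elements. -/
theorem even_card_of_matching {ι : Type*} (s : Finset ι) (R : ι → ι → Prop)
    (hR : ∀ a ∈ s, ∃ b ∈ s, R a b) (hirr : ∀ a ∈ s, ¬ R a a)
    (hsymm : ∀ a ∈ s, ∀ b ∈ s, R a b → R b a)
    (huniq : ∀ a ∈ s, ∀ b ∈ s, ∀ c ∈ s, R a b → R a c → b = c) : Even s.card := by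
  choose g hg hRg using hR
  have h : ∑ _a ∈ s, (1 : ZMod 2) = 0 := by
    refine Finset.sum_involution g (fun a ha => by decide) ?_ hg ?_
    · intro a ha _ h
      have := hRg a ha
      rw [h] at this
      exact hirr a ha this
    · intro a ha
      exact huniq _ (hg a ha) _ (hg _ _) _ ha (hRg _ _) (hsymm _ ha _ (hg a ha) (hRg a ha))
  rw [Finset.sum_const, nsmul_one] at h
  exact (ZMod.natCast_eq_zero_iff_even).1 h

/-! ### Chord systems -/

theorem exists_int_floor (n : ℕ) (k : ℤ) : ∃ F : ℤ → ℤ,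
    (∀ x, F (x + 1) - F x = if x ≡ k [ZMOD n] then 1 else 0) ∧
    ∀ x t, F (x + n * t) - F x = if n = 0 then 0 else t := by
  rcases Nat.eq_zero_or_pos n with rfl | hn
  · refine ⟨fun x => if k < x then 1 else 0, fun x => ?_, fun x t => by simp⟩
    simp only [Nat.cast_zero, Int.modEq_zero_iff]
    split_ifs <;> omega
  · have hn' : (0 : ℤ) < n := by exact_mod_cast hn
    refine ⟨fun x => (x - k - 1) / n, fun x => ?_, fun x t => ?_⟩
    · obtain ⟨a, b, hb, hb', hx⟩ : ∃ a b : ℤ, 0 ≤ b ∧ b < n ∧ x - k = n * a + b :=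
        ⟨(x - k) / n, (x - k) % n, Int.emod_nonneg _ hn'.ne', Int.emod_lt_of_pos _ hn',
          (Int.mul_ediv_add_emod _ _).symm⟩
      have h1 : (x + 1 - k - 1) / (n : ℤ) = a := by
        rw [show x + 1 - k - 1 = b + n * a by linarith, Int.add_mul_ediv_left _ _ hn'.ne',
          Int.ediv_eq_zero_of_lt hb hb', zero_add]
      have hiff : x ≡ k [ZMOD n] ↔ b = 0 := by
        rw [Int.modEq_comm, Int.modEq_iff_dvd, hx, Int.dvd_add_right (dvd_mul_right _ _)]
        constructor
        · intro h
          exact Int.eq_zero_of_dvd_of_nonneg_of_lt hb hb' h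
        · rintro rfl
          simp
      simp only [h1, hiff]
      split_ifs with h
      · rw [show x - k - 1 = (n - 1) + n * (a - 1) by rw [hx, h]; ring,
          Int.add_mul_ediv_left _ _ hn'.ne', Int.ediv_eq_zero_of_lt (by omega) (by omega)]
        ring
      · rw [show x - k - 1 = (b - 1) + n * a by rw [hx]; ring,
          Int.add_mul_ediv_left _ _ hn'.ne', Int.ediv_eq_zero_of_lt (by omega) (by omega)]
        ring
    · simp only
      rw [show x + n * t - k - 1 = (x - k - 1) + n * t by ring, Int.add_mul_ediv_left _ _ hn'.ne',
        if_neg hn.ne']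
      ring

/-- The combinatorial data of a periodic billiard trajectory in a rhombus.  The `j`-th hit of the
boundary happens at parameter `pos j` of an edge, passing from the copy `lev j` of the rhombus to the
next (`dir j = 1`) or the previous one (`dir j = -1`); each copy carries a linear functional whose
level lines are the direction of the trajectory in it, and copies whose numbers agree modulo
`period` carry proportional functionals (`period = 0` when all copies are different).  Between the
hits `j` and `j + 1` the trajectory is a chord of the copy `lev (j + 1)`, with `refl j = -1` when it
crosses the diagonal through `1` and `-1`; it never passes through the centre.  Each
edge of a copy is identified with the opposite edge by the rotation of the rhombus about its
centre. -/
structure ChordSystem where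
  period : ℕ
  α : ℤ → ℝ
  γ : ℤ → ℝ
  ne_zero : ∀ k, α k ≠ 0 ∨ γ k ≠ 0
  proportional : ∀ k, ∃ s : ℤˣ, α (k + period) = ((s : ℤ) : ℝ) * α k ∧
    γ (k + period) = ((s : ℤ) : ℝ) * γ k
  pos : ℤ → ℝ
  pos_mem : ∀ j, pos j ∈ Set.Ioo (0 : ℝ) 1
  dir : ℤ → ℤˣ
  refl : ℤ → ℤˣ
  lev : ℤ → ℤ
  lev_succ : ∀ j, lev (j + 1) = lev j + (dir j : ℤ)
  chord : ∀ j, edgeValue (α (lev (j + 1))) (γ (lev (j + 1))) (-dir j) (pos j) =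
    ((refl j : ℤ) : ℝ) * edgeValue (α (lev (j + 1))) (γ (lev (j + 1))) (dir (j + 1)) (pos (j + 1))
  fold : ∀ j, dir (j + 1) = -dir j → refl j = -1 ∧ pos (j + 1) ≠ pos j
  length : ℕ
  length_pos : 0 < length
  pos_add : ∀ j, pos (j + length) = pos j
  dir_add : ∀ j, dir (j + length) = dir j
  lev_add : ∀ j, lev (j + length) ≡ lev j [ZMOD period]

namespace ChordSystem

variable (S : ChordSystem)

theorem pos_add_mul (j t : ℤ) : S.pos (j + S.length * t) = S.pos j := by
  have h : Function.Periodic S.pos (S.length : ℤ) := S.pos_add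
  have := h.int_mul t j
  rwa [mul_comm] at this

theorem dir_add_mul (j t : ℤ) : S.dir (j + S.length * t) = S.dir j := by
  have h : Function.Periodic S.dir (S.length : ℤ) := S.dir_add
  have := h.int_mul t j
  rwa [mul_comm] at this

theorem lev_add_mul (j t : ℤ) : S.lev (j + S.length * t) ≡ S.lev j [ZMOD S.period] := by
  have h : Function.Periodic (fun j => S.lev j % (S.period : ℤ)) (S.length : ℤ) := S.lev_add
  have := h.int_mul t j
  rwa [mul_comm] at this

/-- The functional of the copy `k` at the boundary point with parameter `x` of the edge `d`. -/
noncomputable def val (k : ℤ) (d : ℤˣ) (x : ℝ) : ℝ := edgeValue (S.α k) (S.γ k) d x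

theorem val_congr {k k' : ℤ} (h : k ≡ k' [ZMOD S.period]) :
    ∃ s : ℤˣ, ∀ d x, S.val k' d x = ((s : ℤ) : ℝ) * S.val k d x := by
  have step : ∀ k, ∃ s : ℤˣ, ∀ d x, S.val (k + S.period) d x = ((s : ℤ) : ℝ) * S.val k d x := by
    intro k
    obtain ⟨s, h1, h2⟩ := S.proportional k
    refine ⟨s, fun d x => ?_⟩
    simp only [val, edgeValue, h1, h2]
    ring
  have hall : ∀ t : ℤ, ∃ s : ℤˣ, ∀ d x,
      S.val (k + S.period * t) d x = ((s : ℤ) : ℝ) * S.val k d x := by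
    intro t
    induction t using Int.induction_on with
    | zero => exact ⟨1, by simp⟩
    | succ i ih =>
      obtain ⟨s, hs⟩ := ih
      obtain ⟨s', hs'⟩ := step (k + S.period * i)
      refine ⟨s' * s, fun d x => ?_⟩
      rw [show k + (S.period : ℤ) * (i + 1) = k + S.period * i + S.period by ring, hs', hs]
      push_cast
      ring
    | pred i ih =>
      obtain ⟨s, hs⟩ := ih
      obtain ⟨s', hs'⟩ := step (k + S.period * (-i - 1))
      rw [show k + (S.period : ℤ) * (-i - 1) + S.period = k + S.period * (-i) by ring] at hs'
      refine ⟨s' * s, fun d x => ?_⟩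
      have h2 : (((s' : ℤ) : ℝ)) * ((s' : ℤ) : ℝ) = 1 := by
        rcases Int.units_eq_one_or s' with rfl | rfl <;> simp
      have := hs' d x
      rw [hs] at this
      push_cast
      rw [mul_assoc, this, ← mul_assoc, h2, one_mul]
  obtain ⟨t, ht⟩ := (Int.modEq_iff_dvd).1 h
  rw [show k' = k + S.period * t by linarith]
  exact hall t

/-- The number of the edge class that forms the edge `d` of the copy `k`: the copies `k` and `k + 1`
share the class `k`. -/
def edgeOf (k : ℤ) (d : ℤˣ) : ℤ := if d = 1 then k else k - 1

/-- The edge class of the `j`-th hit. -/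
def edgeAt (j : ℤ) : ℤ := edgeOf (S.lev j) (S.dir j)

theorem edgeAt_eq (j : ℤ) : S.edgeAt j = edgeOf (S.lev (j + 1)) (-S.dir j) := by
  rw [S.lev_succ]
  rcases Int.units_eq_one_or (S.dir j) with h | h <;> simp [edgeAt, edgeOf, h, sub_eq_add_neg]

theorem edgeOf_modEq {n k k' : ℤ} {d : ℤˣ} : edgeOf k d ≡ edgeOf k' d [ZMOD n] ↔
    k ≡ k' [ZMOD n] := by
  rcases Int.units_eq_one_or d with rfl | rfl
  · simp [edgeOf]
  · simp [edgeOf, Int.modEq_iff_dvd]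

theorem edgeAt_add_mul (j t : ℤ) : S.edgeAt (j + S.length * t) ≡ S.edgeAt j [ZMOD S.period] := by
  rw [edgeAt, S.dir_add_mul]
  exact edgeOf_modEq.2 (S.lev_add_mul j t)

/-- The parameters at which the trajectory hits the edge class `k`. -/
noncomputable def hits (k : ℤ) : Finset ℝ :=
  ((Finset.range S.length).filter fun j : ℕ => S.edgeAt j ≡ k [ZMOD S.period]).image
    fun j : ℕ => S.pos j

variable {S}

theorem mem_hits {k : ℤ} {x : ℝ} :
    x ∈ S.hits k ↔ ∃ j, S.edgeAt j ≡ k [ZMOD S.period] ∧ S.pos j = x := by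
  simp only [hits, Finset.mem_image, Finset.mem_filter, Finset.mem_range]
  constructor
  · rintro ⟨j, ⟨_, h⟩, rfl⟩
    exact ⟨j, h, rfl⟩
  · rintro ⟨j, h, rfl⟩
    have hl : (0 : ℤ) < S.length := by exact_mod_cast S.length_pos
    have hj : j % S.length + S.length * (j / S.length) = j := Int.emod_add_mul_ediv _ _
    have h1 : ((j % S.length).toNat : ℤ) = j % S.length :=
      Int.toNat_of_nonneg (Int.emod_nonneg _ hl.ne')
    have h2 := Int.emod_lt_of_pos j hl
    refine ⟨(j % S.length).toNat, ⟨by omega, ?_⟩, ?_⟩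
    · rw [h1]
      refine (S.edgeAt_add_mul _ (j / S.length)).symm.trans ?_
      rwa [hj]
    · rw [h1, ← S.pos_add_mul _ (j / S.length), hj]

theorem hits_congr {k k' : ℤ} (h : k ≡ k' [ZMOD S.period]) : S.hits k = S.hits k' := by
  ext x
  rw [mem_hits, mem_hits]
  exact exists_congr fun j => and_congr_left fun _ => ⟨fun h' => h'.trans h, fun h' => h'.trans h.symm⟩

theorem pos_mem_hits (j : ℤ) : S.pos j ∈ S.hits (S.edgeAt j) := mem_hits.2 ⟨j, Int.ModEq.refl _, rfl⟩

theorem Ioo_of_mem_hits {k : ℤ} {x : ℝ} (h : x ∈ S.hits k) : x ∈ Set.Ioo (0 : ℝ) 1 := by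
  obtain ⟨j, _, rfl⟩ := mem_hits.1 h
  exact S.pos_mem j

variable (S) in
/-- The boundary points `(d, x)` and `(d', x')` of the copy `k` are the ends of a chord along a level
line, which crosses the diagonal between `1` and `-1` when `r = -1`. -/
def IsChord (k : ℤ) (r d : ℤˣ) (x : ℝ) (d' : ℤˣ) (x' : ℝ) : Prop :=
  (d' = d → r = -1) ∧ S.val k d x = ((r : ℤ) : ℝ) * S.val k d' x'

theorem IsChord.symm {k : ℤ} {r d d' : ℤˣ} {x x' : ℝ} (h : S.IsChord k r d x d' x') :
    S.IsChord k r d' x' d x := by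
  refine ⟨fun h' => h.1 h'.symm, ?_⟩
  rw [h.2]
  rcases Int.units_eq_one_or r with rfl | rfl <;> simp

theorem IsChord.congr {k k' : ℤ} (hk : k ≡ k' [ZMOD S.period]) {r d d' : ℤˣ} {x x' : ℝ}
    (h : S.IsChord k r d x d' x') : S.IsChord k' r d x d' x' := by
  obtain ⟨s, hs⟩ := S.val_congr hk
  refine ⟨h.1, ?_⟩
  rw [hs, hs, h.2]
  ring

theorem isChord_succ (j : ℤ) : S.IsChord (S.lev (j + 1)) (S.refl j) (-S.dir j) (S.pos j)
    (S.dir (j + 1)) (S.pos (j + 1)) := ⟨fun h => (S.fold j h).1, S.chord j⟩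

theorem IsChord.unique {k : ℤ} {r₁ r₂ d d₁ d₂ : ℤˣ} {x x₁ x₂ : ℝ} (h₁ : S.IsChord k r₁ d x d₁ x₁)
    (h₂ : S.IsChord k r₂ d x d₂ x₂) (hx : x ∈ Set.Ioo (0 : ℝ) 1) (hx₁ : x₁ ∈ Set.Ioo (0 : ℝ) 1)
    (hx₂ : x₂ ∈ Set.Ioo (0 : ℝ) 1) : r₁ = r₂ ∧ d₁ = d₂ ∧ x₁ = x₂ :=
  chord_unique (S.ne_zero k) hx hx₁ hx₂ h₁.1 h₂.1 h₁.2 h₂.2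

/-- A hit of the edge `d` of the copy `k` is an end of a chord of the trajectory in this copy, either
the one that it terminates or the one that it starts. -/
theorem exists_chord_at {k j : ℤ} {d : ℤˣ} (h : S.edgeAt j ≡ edgeOf k d [ZMOD S.period]) :
    (S.dir j = d ∧ S.lev j ≡ k [ZMOD S.period] ∧
      S.IsChord k (S.refl (j - 1)) d (S.pos j) (-S.dir (j - 1)) (S.pos (j - 1)) ∧
      S.edgeAt (j - 1) ≡ edgeOf k (-S.dir (j - 1)) [ZMOD S.period]) ∨
    (S.dir j = -d ∧ S.lev (j + 1) ≡ k [ZMOD S.period] ∧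
      S.IsChord k (S.refl j) d (S.pos j) (S.dir (j + 1)) (S.pos (j + 1)) ∧
      S.edgeAt (j + 1) ≡ edgeOf k (S.dir (j + 1)) [ZMOD S.period]) := by
  by_cases hd : S.dir j = d
  · left
    have hk : S.lev j ≡ k [ZMOD S.period] := by
      rw [edgeAt, hd] at h
      exact edgeOf_modEq.1 h
    have := S.isChord_succ (j - 1)
    rw [sub_add_cancel, hd] at this
    refine ⟨hd, hk, this.symm.congr hk, ?_⟩
    rw [edgeAt_eq, sub_add_cancel]
    exact edgeOf_modEq.2 hk
  · right
    have hd' : S.dir j = -d := by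
      rcases Int.units_eq_one_or d with rfl | rfl <;>
      rcases Int.units_eq_one_or (S.dir j) with h | h <;> simp_all
    have hk : S.lev (j + 1) ≡ k [ZMOD S.period] := by
      rw [edgeAt_eq, hd', neg_neg] at h
      exact edgeOf_modEq.1 h
    have := S.isChord_succ j
    rw [hd', neg_neg] at this
    exact ⟨hd', hk, this.congr hk, edgeOf_modEq.2 hk⟩

theorem exists_chord {k : ℤ} {d : ℤˣ} {x : ℝ} (h : x ∈ S.hits (edgeOf k d)) :
    ∃ r d' x', x' ∈ S.hits (edgeOf k d') ∧ S.IsChord k r d x d' x' ∧ (d' = d → x' ≠ x) := by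
  obtain ⟨j, hj, rfl⟩ := mem_hits.1 h
  rcases exists_chord_at hj with ⟨h1, h2, h3, h4⟩ | ⟨h1, h2, h3, h4⟩
  · refine ⟨_, _, _, mem_hits.2 ⟨_, h4, rfl⟩, h3, fun h => ?_⟩
    have := S.fold (j - 1)
    rw [sub_add_cancel] at this
    exact (this (by rw [h1, ← h])).2.symm
  · refine ⟨_, _, _, mem_hits.2 ⟨_, h4, rfl⟩, h3, fun h => ?_⟩
    exact (S.fold j (by rw [h1, h, neg_neg])).2

/-- A line through a hit leaves the rhombus at a hit, and does not pass through the centre. -/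
theorem IsChord.mem_hits {k : ℤ} {r d d' : ℤˣ} {x x' : ℝ} (h : S.IsChord k r d x d' x')
    (hx : x ∈ S.hits (edgeOf k d)) (hx' : x' ∈ Set.Ioo (0 : ℝ) 1) :
    x' ∈ S.hits (edgeOf k d') ∧ (d' = d → x' ≠ x) := by
  obtain ⟨r₁, d₁, x₁, h1, h2, h3⟩ := exists_chord hx
  obtain ⟨rfl, rfl, rfl⟩ := h.unique h2 (Ioo_of_mem_hits hx) hx' (Ioo_of_mem_hits h1)
  exact ⟨h1, h3⟩

end ChordSystem

/-! ### Parity of the hits along chords -/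

namespace ChordSystem

variable {S : ChordSystem}

/-- The edge classes of a copy have hits of the same parity, since the chords match them up. -/
theorem even_card_hits_succ (k : ℤ) :
    Even ((S.hits k).card + (S.hits (k - 1)).card) := by
  have h := even_card_of_matching
    ((S.hits k).map (Function.Embedding.sectR (1 : ℤˣ) ℝ) ∪
      (S.hits (k - 1)).map (Function.Embedding.sectR (-1 : ℤˣ) ℝ))
    (fun p q => p ≠ q ∧ ∃ r, S.IsChord k r p.1 p.2 q.1 q.2) ?_ (fun _ _ h => h.1 rfl)
    (fun _ _ _ _ h => ⟨h.1.symm, h.2.imp fun _ => IsChord.symm⟩) ?_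
  · rwa [Finset.card_union_of_disjoint, Finset.card_map, Finset.card_map] at h
    rw [Finset.disjoint_left]
    simp
  all_goals
    have hmem : ∀ p : ℤˣ × ℝ, p ∈ ((S.hits k).map
        (Function.Embedding.sectR (1 : ℤˣ) ℝ) ∪
      (S.hits (k - 1)).map (Function.Embedding.sectR (-1 : ℤˣ) ℝ)) ↔
        p.2 ∈ S.hits (edgeOf k p.1) := by
      rintro ⟨d, x⟩
      rcases Int.units_eq_one_or d with rfl | rfl <;> simp [edgeOf]
  · rintro ⟨d, x⟩ hp
    rw [hmem] at hp
    obtain ⟨r, d', x', h1, h2, h3⟩ := exists_chord hp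
    refine ⟨(d', x'), (hmem _).2 h1, fun h => ?_, r, h2⟩
    exact h3 (Prod.ext_iff.1 h).1.symm (Prod.ext_iff.1 h).2.symm
  · rintro ⟨d, x⟩ hp ⟨d₁, x₁⟩ hp₁ ⟨d₂, x₂⟩ hp₂ ⟨_, r₁, h₁⟩ ⟨_, r₂, h₂⟩
    rw [hmem] at hp hp₁ hp₂
    obtain ⟨_, rfl, rfl⟩ := h₁.unique h₂ (Ioo_of_mem_hits hp) (Ioo_of_mem_hits hp₁)
      (Ioo_of_mem_hits hp₂)
    rfl

theorem even_card_hits_iff (k k' : ℤ) : Even (S.hits k).card ↔ Even (S.hits k').card := by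
  have h : ∀ k, Even (S.hits k).card ↔ Even (S.hits 0).card := by
    intro k
    induction k using Int.induction_on with
    | zero => rfl
    | succ i ih =>
      have := S.even_card_hits_succ (i + 1)
      rw [add_sub_cancel_right, Nat.even_add] at this
      exact this.trans ih
    | pred i ih =>
      have := S.even_card_hits_succ (-i)
      rw [Nat.even_add] at this
      exact this.symm.trans ih
  rw [h k, h k']

/-- A chord of the trajectory extends to an affine map between the edges that carries hits to
hits in both directions. -/
theorem IsChord.exists_affine {k : ℤ} {r d d' : ℤˣ} {x x' : ℝ} (h : S.IsChord k r d x d' x')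
    (hx : x ∈ S.hits (edgeOf k d)) (hx' : x' ∈ S.hits (edgeOf k d')) :
    ∃ q : ℝ, q ≠ 0 ∧ (0 < q ↔ d' ≠ d) ∧
      (∀ z, S.val k d z = ((r : ℤ) : ℝ) * S.val k d' (x' + q * (z - x))) ∧
      (∀ z ∈ Set.Ioo (0 : ℝ) 1, x' + q * (z - x) ∈ Set.Ioo (0 : ℝ) 1 →
        (z ∈ S.hits (edgeOf k d) ↔ x' + q * (z - x) ∈ S.hits (edgeOf k d')) ∧
        (z ∈ S.hits (edgeOf k d) → d' = d → x' + q * (z - x) ≠ z)) ∧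
      ((q = -1 ∧ d' = d) ∨ (q = x' / x) ∨ (q = (1 - x') / (1 - x))) := by
  obtain ⟨q, h1, h2, h3, h4⟩ := exists_affine_of_chord (Ioo_of_mem_hits hx) (Ioo_of_mem_hits hx')
    h.1 h.2
  refine ⟨q, h1, h2, h3, fun z hz hz' => ⟨⟨fun hm => ?_, fun hm => ?_⟩, fun hm => ?_⟩, h4⟩
  · exact (IsChord.mem_hits ⟨h.1, h3 z⟩ hm hz').1
  · exact (IsChord.mem_hits (IsChord.symm ⟨h.1, h3 z⟩) hm hz).1
  · exact (IsChord.mem_hits ⟨h.1, h3 z⟩ hm hz').2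

/-- The ranks of the ends of a chord have the same parity when the chord cuts off a vertex of
the rhombus, and opposite parities when it joins opposite edges. -/
theorem IsChord.even_rank {k : ℤ} {r d d' : ℤˣ} {x x' : ℝ} (h : S.IsChord k r d x d' x')
    (hx : x ∈ S.hits (edgeOf k d)) (hx' : x' ∈ S.hits (edgeOf k d')) (hne : d' = d → x' ≠ x) :
    (Even (rankIn (S.hits (edgeOf k d)) x) ↔ Even (rankIn (S.hits (edgeOf k d')) x')) ↔
      d' ≠ d := by
  obtain ⟨q, hq, hqd, -, hmap, hcase⟩ := h.exists_affine hx hx'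
  obtain ⟨hx0, hx1⟩ := Ioo_of_mem_hits hx
  obtain ⟨hx0', hx1'⟩ := Ioo_of_mem_hits hx'
  have hx2 : 0 < 1 - x := by linarith
  have hx2' : 0 < 1 - x' := by linarith
  rcases hcase with ⟨rfl, rfl⟩ | rfl | rfl
  · -- The hits between the ends are matched by the reflection that exchanges the ends.
    have hxx := hne rfl
    wlog hlt : x < x' generalizing x x'
    · have := this (x := x') (x' := x) hx hx0' hx1' hx0 hx1 hx2' hx2 h.symm hx'
        (fun _ => hxx.symm) (fun z hz hz' => by
          have h0 : x + -1 * (z - x') = x' + -1 * (z - x) := by ring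
          rw [h0] at hz' ⊢
          exact hmap z hz hz') hxx.symm (lt_of_le_of_ne (not_lt.1 hlt) hxx)
      exact iff_comm.trans this
    have he : Even ((S.hits (edgeOf k d')).filter (fun z => x < z ∧ z < x')).card := by
      refine even_card_of_matching _ (fun a b => a + b = x + x') ?_ ?_
        (fun a _ b _ h => by linarith) (fun a _ b _ c _ h h' => by linarith)
      · intro a ha
        rw [Finset.mem_filter] at ha
        refine ⟨x + x' - a, Finset.mem_filter.2 ⟨?_, by linarith, by linarith⟩, by ring⟩
        have := (hmap a ⟨by linarith, by linarith⟩ ⟨by linarith, by linarith⟩).1.1 ha.1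
        rwa [show x' + -1 * (a - x) = x + x' - a by ring] at this
      · intro a ha h
        rw [Finset.mem_filter] at ha
        exact (hmap a ⟨by linarith, by linarith⟩ ⟨by linarith, by linarith⟩).2 ha.1 rfl (by linarith)
    rw [rankIn_between hx hlt]
    simp only [Nat.even_add_one, Nat.even_add, he, iff_true, ne_eq, not_true_eq_false, iff_false]
    tauto
  · have hd : d' ≠ d := hqd.1 (by positivity)
    have hf : ∀ z, x' + x' / x * (z - x) = x' / x * z := by intro z; field_simp; ring
    have heq : (S.hits (edgeOf k d')).filter (· < x') =
        ((S.hits (edgeOf k d)).filter (· < x)).image (fun z => x' / x * z) := by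
      ext z
      simp only [Finset.mem_image, Finset.mem_filter]
      constructor
      · rintro ⟨hz, hzx⟩
        have hz0 := (Ioo_of_mem_hits hz).1
        have h1 : x / x' * z < x := by rw [div_mul_eq_mul_div, div_lt_iff₀ hx0']; nlinarith
        have h2 : x' / x * (x / x' * z) = z := by field_simp
        refine ⟨x / x' * z, ⟨(hmap _ ⟨by positivity, by linarith⟩ ?_).1.2 ?_, h1⟩, h2⟩
        · rw [hf, h2]
          exact ⟨by linarith, by linarith⟩
        · rwa [hf, h2]
      · rintro ⟨a, ⟨ha, hax⟩, rfl⟩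
        have ha0 := (Ioo_of_mem_hits ha).1
        have h1 : x' / x * a < x' := by rw [div_mul_eq_mul_div, div_lt_iff₀ hx0]; nlinarith
        have h2 := (hmap a ⟨by linarith, by linarith⟩
          (by rw [hf]; exact ⟨by positivity, by linarith⟩)).1.1 ha
        rw [hf] at h2
        exact ⟨h2, h1⟩
    have : rankIn (S.hits (edgeOf k d')) x' = rankIn (S.hits (edgeOf k d)) x := by
      rw [rankIn, heq, Finset.card_image_of_injective _ (mul_right_injective₀ hq)]
      rfl
    simp [this, hd]
  · have hd : d' ≠ d := hqd.1 (by positivity)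
    have hf : ∀ z, x' + (1 - x') / (1 - x) * (z - x) = 1 - (1 - x') / (1 - x) * (1 - z) := by
      intro z; field_simp; ring
    have heq : (S.hits (edgeOf k d')).filter (x' < ·) =
        ((S.hits (edgeOf k d)).filter (x < ·)).image (fun z => 1 - (1 - x') / (1 - x) * (1 - z)) := by
      ext z
      simp only [Finset.mem_image, Finset.mem_filter]
      constructor
      · rintro ⟨hz, hzx⟩
        have hz0 : 0 < 1 - z := by linarith [(Ioo_of_mem_hits hz).2]
        have h1 : (1 - x) / (1 - x') * (1 - z) < 1 - x := by
          rw [div_mul_eq_mul_div, div_lt_iff₀ hx2']; nlinarith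
        have h0 : 0 < (1 - x) / (1 - x') * (1 - z) := by positivity
        have h2 : 1 - (1 - x') / (1 - x) * (1 - (1 - (1 - x) / (1 - x') * (1 - z))) = z := by
          field_simp; ring
        refine ⟨1 - (1 - x) / (1 - x') * (1 - z),
          ⟨(hmap _ ⟨by linarith, by linarith⟩ ?_).1.2 ?_, by linarith⟩, h2⟩
        · rw [hf, h2]
          exact ⟨by linarith, by linarith⟩
        · rwa [hf, h2]
      · rintro ⟨a, ⟨ha, hax⟩, rfl⟩
        have ha0 : 0 < 1 - a := by linarith [(Ioo_of_mem_hits ha).2]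
        have h1 : (1 - x') / (1 - x) * (1 - a) < 1 - x' := by
          rw [div_mul_eq_mul_div, div_lt_iff₀ hx2]; nlinarith
        have h0 : 0 < (1 - x') / (1 - x) * (1 - a) := by positivity
        have h2 := (hmap a ⟨by linarith, by linarith⟩
          (by rw [hf]; exact ⟨by linarith, by linarith⟩)).1.1 ha
        rw [hf] at h2
        exact ⟨h2, by linarith⟩
    have hcard : ((S.hits (edgeOf k d')).filter (x' < ·)).card =
        ((S.hits (edgeOf k d)).filter (x < ·)).card := by
      rw [heq, Finset.card_image_of_injective]
      intro a b hab
      have : (1 - x') / (1 - x) * (1 - a) = (1 - x') / (1 - x) * (1 - b) := by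
        simp only at hab
        linarith
      have := mul_left_cancel₀ hq this
      linarith
    have h1 := rankIn_add_card_gt hx
    have h2 := rankIn_add_card_gt hx'
    have h3 := S.even_card_hits_iff (edgeOf k d) (edgeOf k d')
    rw [← h1, ← h2, hcard] at h3
    simp only [Nat.even_add_one, Nat.even_add] at h3
    simp only [ne_eq, hd, not_false_eq_true, iff_true]
    tauto

end ChordSystem

/-! ### Alternation of the directions on an edge class -/

namespace ChordSystem

variable {S : ChordSystem}

variable (S) in
/-- The number of hits to the left of the `j`-th hit on its edge class. -/
noncomputable def rank (j : ℤ) : ℕ := rankIn (S.hits (S.edgeAt j)) (S.pos j)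

theorem rank_congr {i j : ℤ} (h : S.edgeAt i ≡ S.edgeAt j [ZMOD S.period])
    (h' : S.pos i = S.pos j) : S.rank i = S.rank j := by
  rw [rank, rank, hits_congr h, h']

theorem pos_mem_hits_left (j : ℤ) : S.pos j ∈ S.hits (edgeOf (S.lev (j + 1)) (-S.dir j)) := by
  rw [← edgeAt_eq]
  exact pos_mem_hits j

theorem pos_mem_hits_right (j : ℤ) : S.pos j ∈ S.hits (edgeOf (S.lev j) (S.dir j)) :=
  pos_mem_hits j

theorem eq_neg_of_ne {d d' : ℤˣ} (h : d' ≠ d) : d' = -d := by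
  rcases Int.units_eq_one_or d with rfl | rfl <;> rcases Int.units_eq_one_or d' with rfl | rfl <;>
    simp_all

theorem ne_neg_iff {d d' : ℤˣ} : d' ≠ -d ↔ d' = d := by
  rcases Int.units_eq_one_or d with rfl | rfl <;> rcases Int.units_eq_one_or d' with rfl | rfl <;>
    decide

theorem even_rank_succ (j : ℤ) : (Even (S.rank j) ↔ Even (S.rank (j + 1))) ↔
    S.dir (j + 1) = S.dir j := by
  have := (isChord_succ (S := S) j).even_rank (pos_mem_hits_left j) (pos_mem_hits_right _)
    fun h => (S.fold j h).2
  rw [← edgeAt_eq, ne_neg_iff] at this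
  exact this

/-- The hits of an edge class are passed in alternating directions. -/
theorem exists_dir_eq_rank : ∃ θ : ℤˣ, ∀ j, S.dir j = θ * (-1) ^ S.rank j := by
  have hstep : ∀ j, S.dir (j + 1) * (-1) ^ S.rank (j + 1) = S.dir j * (-1) ^ S.rank j := by
    intro j
    have h := even_rank_succ (S := S) j
    by_cases h1 : Even (S.rank j) <;> by_cases h2 : Even (S.rank (j + 1))
    · rw [h1.neg_one_pow, h2.neg_one_pow, h.1 (by tauto)]
    · rw [h1.neg_one_pow, (Nat.not_even_iff_odd.1 h2).neg_one_pow, eq_neg_of_ne (mt h.2 (by tauto))]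
      simp
    · rw [h2.neg_one_pow, (Nat.not_even_iff_odd.1 h1).neg_one_pow, eq_neg_of_ne (mt h.2 (by tauto))]
      simp
    · rw [(Nat.not_even_iff_odd.1 h2).neg_one_pow, (Nat.not_even_iff_odd.1 h1).neg_one_pow,
        h.1 (by tauto)]
  have hall : ∀ j, S.dir j * (-1) ^ S.rank j = S.dir 0 * (-1) ^ S.rank 0 := by
    intro j
    induction j using Int.induction_on with
    | zero => rfl
    | succ i ih => rw [hstep, ih]
    | pred i ih =>
      rw [← ih]
      have := hstep (-i - 1)
      rw [sub_add_cancel] at this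
      exact this.symm
  refine ⟨S.dir 0 * (-1) ^ S.rank 0, fun j => ?_⟩
  rw [← hall j, mul_assoc, ← pow_add, Even.neg_one_pow ⟨_, rfl⟩, mul_one]

theorem dir_congr {i j : ℤ} (h : S.edgeAt i ≡ S.edgeAt j [ZMOD S.period])
    (h' : S.pos i = S.pos j) : S.dir i = S.dir j := by
  obtain ⟨θ, hθ⟩ := S.exists_dir_eq_rank
  rw [hθ, hθ, rank_congr h h']

/-! ### Time reversal along a strip without vertices -/

variable (S) in
/-- The hits `j` and `i` bound a strip on their edge class: the position of `i` is the neighbour of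
the position of `j`, on the right if an even number of hits lie to the left of `j`, else on the left. -/
def IsStrip (j i : ℤ) : Prop :=
  S.edgeAt i ≡ S.edgeAt j [ZMOD S.period] ∧ S.pos i ≠ S.pos j ∧
    (∀ z ∈ S.hits (S.edgeAt j), ¬ (S.pos j < z ∧ z < S.pos i) ∧ ¬ (S.pos i < z ∧ z < S.pos j)) ∧
    (S.pos j < S.pos i ↔ Even (S.rank j))

theorem exists_isStrip (h : Even (S.hits 0).card) (j : ℤ) : ∃ i, S.IsStrip j i := by
  by_cases hr : Even (S.rank j)
  · obtain ⟨y, hy, hlt, hmin⟩ := exists_next_of_even_rankIn (pos_mem_hits j)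
      ((even_card_hits_iff _ _).1 h) hr
    obtain ⟨i, hi, rfl⟩ := mem_hits.1 hy
    exact ⟨i, hi, hlt.ne', fun z hz => ⟨hmin z hz, fun h => lt_asymm (h.1.trans h.2) hlt⟩, by tauto⟩
  · obtain ⟨y, hy, hlt, hmin⟩ := exists_prev_of_odd_rankIn hr
    obtain ⟨i, hi, rfl⟩ := mem_hits.1 hy
    exact ⟨i, hi, hlt.ne, fun z hz => ⟨fun h => lt_asymm (h.1.trans h.2) hlt, hmin z hz⟩,
      iff_of_false hlt.not_gt hr⟩

theorem IsStrip.dir_eq {j i : ℤ} (h : S.IsStrip j i) : S.dir i = -S.dir j := by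
  obtain ⟨h1, h2, h3, h4⟩ := h
  obtain ⟨θ, hθ⟩ := S.exists_dir_eq_rank
  have hi : S.pos i ∈ S.hits (S.edgeAt j) := mem_hits.2 ⟨i, h1, rfl⟩
  have hr : S.rank i = rankIn (S.hits (S.edgeAt j)) (S.pos i) := by rw [rank, hits_congr h1]
  rcases lt_or_gt_of_ne h2 with h | h
  · have : S.rank j = S.rank i + 1 := by
      rw [hr]; exact rankIn_succ hi h fun z hz => (h3 z hz).2
    rw [hθ, hθ, this, pow_succ]
    simp
  · have : S.rank i = S.rank j + 1 := by
      rw [hr]; exact rankIn_succ (pos_mem_hits j) h fun z hz => (h3 z hz).1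
    rw [hθ, hθ, this, pow_succ]
    simp

theorem IsStrip.congr {j i j' i' : ℤ} (h : S.IsStrip j i)
    (hj : S.edgeAt j' ≡ S.edgeAt j [ZMOD S.period]) (hj' : S.pos j' = S.pos j)
    (hi : S.edgeAt i' ≡ S.edgeAt i [ZMOD S.period]) (hi' : S.pos i' = S.pos i) :
    S.IsStrip j' i' := by
  obtain ⟨h1, h2, h3, h4⟩ := h
  refine ⟨hi.trans (h1.trans hj.symm), by rwa [hi', hj'], ?_, ?_⟩
  · rwa [hits_congr hj, hi', hj']
  · rwa [rank_congr hj hj', hi', hj']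

/-- A strip is carried to a strip: the chords that start at its two ends join the same edges, because
no hit, and hence no vertex, lies inside it. -/
theorem IsStrip.step (hs : Even (S.hits 0).card) {j i : ℤ} (h : S.IsStrip j i) :
    S.IsStrip (j + 1) (i - 1) ∧ S.refl (i - 1) = S.refl j := by
  obtain ⟨i', h'⟩ := exists_isStrip hs (j + 1)
  have hdir := h.dir_eq
  have hc := isChord_succ (S := S) j
  have hx := pos_mem_hits_left (S := S) j
  have hx' := pos_mem_hits_right (S := S) (j + 1)
  have hrank := even_rank_succ (S := S) j
  have h1 := h.1
  rw [edgeAt_eq S j] at h1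
  obtain ⟨q, hq, hqd, hval, hmap, -⟩ := hc.exists_affine hx hx'
  have hy : S.pos i ∈ S.hits (edgeOf (S.lev (j + 1)) (-S.dir j)) := mem_hits.2 ⟨i, h1, rfl⟩
  have hy' : S.pos i' ∈ S.hits (edgeOf (S.lev (j + 1)) (S.dir (j + 1))) :=
    mem_hits.2 ⟨i', h'.1, rfl⟩
  obtain ⟨-, hne, hbet, hside⟩ := h
  obtain ⟨-, hne', hbet', hside'⟩ := id h'
  rw [edgeAt_eq S j] at hbet
  rw [edgeAt] at hbet'
  have hxI := Ioo_of_mem_hits hx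
  have hxI' := Ioo_of_mem_hits hx'
  have hyI := Ioo_of_mem_hits hy
  have hyI' := Ioo_of_mem_hits hy'
  have hqs : 0 < q ↔ (S.pos j < S.pos i ↔ S.pos (j + 1) < S.pos i') := by
    rw [hqd, ne_neg_iff, ← hrank, hside, hside']
  have heq : S.pos (j + 1) + q * (S.pos i - S.pos j) = S.pos i' := by
    generalize S.pos j = x at *
    generalize S.pos (j + 1) = x' at *
    generalize S.pos i = y at *
    generalize S.pos i' = y' at *
    have hu : y - x ≠ 0 := sub_ne_zero.2 hne
    have hu' : y' - x' ≠ 0 := sub_ne_zero.2 hne'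
    have hpos : 0 < q * (y - x) * (y' - x') := by
      rcases lt_or_gt_of_ne hq with hq0 | hq0 <;> rcases lt_or_gt_of_ne hne with h | h <;>
        rcases lt_or_gt_of_ne hne' with h' | h'
      · exact absurd (hqs.2 (iff_of_false h.not_gt h'.not_gt)) hq0.not_gt
      · exact mul_pos (mul_pos_of_neg_of_neg hq0 (by linarith)) (by linarith)
      · exact mul_pos_of_neg_of_neg (mul_neg_of_neg_of_pos hq0 (by linarith)) (by linarith)
      · exact absurd (hqs.2 (iff_of_true h h')) hq0.not_gt
      · exact mul_pos_of_neg_of_neg (mul_neg_of_pos_of_neg hq0 (by linarith)) (by linarith)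
      · exact absurd ((hqs.1 hq0).2 h') h.not_gt
      · exact absurd ((hqs.1 hq0).1 h) h'.not_gt
      · exact mul_pos (mul_pos hq0 (by linarith)) (by linarith)
    by_contra hcon
    set t := (y' - x') / (q * (y - x)) with ht
    have htpos : 0 < t := by
      have hne0 : q * (y - x) ≠ 0 := mul_ne_zero hq hu
      have : t = q * (y - x) * (y' - x') / (q * (y - x)) ^ 2 := by rw [ht]; field_simp
      rw [this]
      positivity
    have hty : y' - x' = t * (q * (y - x)) := by rw [ht]; field_simp
    have between : ∀ {a b s : ℝ}, a ∈ Set.Ioo (0 : ℝ) 1 → b ∈ Set.Ioo (0 : ℝ) 1 → b ≠ a → 0 < s →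
        s < 1 → a + s * (b - a) ∈ Set.Ioo (0 : ℝ) 1 ∧
          ((a < a + s * (b - a) ∧ a + s * (b - a) < b) ∨
            (b < a + s * (b - a) ∧ a + s * (b - a) < a)) := by
      rintro a b s ⟨ha, ha'⟩ ⟨hb, hb'⟩ hab hs hs'
      rcases lt_or_gt_of_ne hab with h | h
      · have h1 : b < a + s * (b - a) := by nlinarith
        have h2 : a + s * (b - a) < a := by nlinarith
        exact ⟨⟨by linarith, by linarith⟩, Or.inr ⟨h1, h2⟩⟩
      · have h1 : a < a + s * (b - a) := by nlinarith
        have h2 : a + s * (b - a) < b := by nlinarith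
        exact ⟨⟨by linarith, by linarith⟩, Or.inl ⟨h1, h2⟩⟩
    rcases lt_trichotomy t 1 with ht1 | ht1 | ht1
    · obtain ⟨hI, hb⟩ := between hxI hyI hne htpos ht1
      have hz : x' + q * (x + t * (y - x) - x) = y' := by linear_combination -hty
      have hm := (hmap _ hI (by rw [hz]; exact hyI')).1.2 (by rw [hz]; exact hy')
      rcases hb with hb | hb
      · exact (hbet _ hm).1 hb
      · exact (hbet _ hm).2 hb
    · rw [ht1, one_mul] at hty
      exact hcon (by linarith)
    · have ht0 : 0 < t⁻¹ := inv_pos.2 htpos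
      obtain ⟨hI, hb⟩ := between hxI' hyI' hne' ht0 (inv_lt_one_of_one_lt₀ ht1)
      have hz : x' + t⁻¹ * (y' - x') = x' + q * (y - x) := by
        rw [hty]; field_simp
      rw [hz] at hI hb
      have hm := (hmap _ hyI hI).1.1 hy
      rcases hb with hb | hb
      · exact (hbet' _ hm).1 hb
      · exact (hbet' _ hm).2 hb
  have hchord : S.IsChord (S.lev (j + 1)) (S.refl j) (-S.dir j) (S.pos i) (S.dir (j + 1))
      (S.pos i') := by
    refine ⟨hc.1, ?_⟩
    rw [hval, heq]
  rcases exists_chord_at h1 with ⟨-, -, h3, h4⟩ | ⟨h2, -, -, -⟩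
  · obtain ⟨e1, e2, e3⟩ := hchord.unique h3 hyI hyI' (S.pos_mem _)
    refine ⟨h'.congr (Int.ModEq.refl _) rfl ?_ e3.symm, e1.symm⟩
    rw [← e2] at h4
    exact h4.trans h'.1.symm
  · rw [hdir, neg_neg] at h2
    exact absurd h2 (by rcases Int.units_eq_one_or (S.dir j) with h | h <;> rw [h] <;> decide)

/-- If every edge class has an even number of hits, then the trajectory is, up to the rotation of
the rhombus about its centre, its own time reversal. -/
theorem exists_reversal (hs : Even (S.hits 0).card) : ∃ a : ℤ, S.dir (a + 1) = -S.dir a ∧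
    ∀ j, S.dir (2 * a + 1 - j) = -S.dir j ∧ S.refl (2 * a - j) = S.refl j := by
  obtain ⟨N, hN⟩ := exists_isStrip hs 0
  have hnat : ∀ m : ℕ, S.IsStrip m (N - m) := by
    intro m
    induction m with
    | zero => simpa using hN
    | succ m ih =>
      have := (ih.step hs).1
      push_cast
      rwa [← sub_sub]
  have hall : ∀ j : ℤ, S.IsStrip j (N - j) := by
    intro j
    have hl : (1 : ℤ) ≤ S.length := by exact_mod_cast S.length_pos
    have hm : 0 ≤ j + S.length * |j| := by nlinarith [neg_abs_le j, abs_nonneg j]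
    have := hnat (j + S.length * |j|).toNat
    rw [Int.toNat_of_nonneg hm] at this
    refine this.congr (S.edgeAt_add_mul _ _).symm (S.pos_add_mul _ _).symm ?_ ?_
    · have h := S.edgeAt_add_mul (N - j) (-|j|)
      rw [show N - (j + S.length * |j|) = N - j + S.length * (-|j|) by ring]
      exact h.symm
    · rw [show N - (j + S.length * |j|) = N - j + S.length * (-|j|) by ring, S.pos_add_mul]
  rcases Int.even_or_odd' N with ⟨a, ha | ha⟩
  · have := (hall a).2.1
    rw [ha, show 2 * a - a = a by ring] at this
    exact absurd rfl this
  · subst ha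
    refine ⟨a, ?_, fun j => ⟨(hall j).dir_eq, ?_⟩⟩
    · have := (hall a).dir_eq
      rwa [show 2 * a + 1 - a = a + 1 by ring] at this
    · have := ((hall j).step hs).2
      rwa [show 2 * a + 1 - j - 1 = 2 * a - j by ring] at this

/-! ### Winding around the vertices -/

variable (S) in
/-- The hits `j` and `i` agree in position, direction and copy. -/
def SameState (j i : ℤ) : Prop :=
  S.dir i = S.dir j ∧ S.pos i = S.pos j ∧ S.lev i ≡ S.lev j [ZMOD S.period]

theorem SameState.step {j i : ℤ} (h : S.SameState j i) :
    S.SameState (j + 1) (i + 1) ∧ S.refl i = S.refl j := by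
  obtain ⟨h1, h2, h3⟩ := h
  have hlev : S.lev (i + 1) ≡ S.lev (j + 1) [ZMOD S.period] := by
    rw [S.lev_succ, S.lev_succ, h1]
    exact h3.add_right _
  have hi := (isChord_succ (S := S) i).congr hlev
  rw [h1, h2] at hi
  obtain ⟨e1, e2, e3⟩ := hi.unique (isChord_succ j) (S.pos_mem _) (S.pos_mem _) (S.pos_mem _)
  exact ⟨⟨e2, e3, hlev⟩, e1⟩

theorem SameState.add_nat {j i : ℤ} (h : S.SameState j i) (m : ℕ) :
    S.SameState (j + m) (i + m) := by
  induction m with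
  | zero => simpa using h
  | succ m ih =>
    push_cast
    rw [← add_assoc, ← add_assoc]
    exact ih.step.1

theorem SameState.shift {j i t : ℤ} (h : S.SameState (j + S.length * t) (i + S.length * t)) :
    S.SameState j i := by
  obtain ⟨h1, h2, h3⟩ := h
  rw [S.dir_add_mul, S.dir_add_mul] at h1
  rw [S.pos_add_mul, S.pos_add_mul] at h2
  exact ⟨h1, h2, (S.lev_add_mul _ _).symm.trans (h3.trans (S.lev_add_mul _ _))⟩

theorem SameState.add {j i : ℤ} (h : S.SameState j i) (m : ℤ) : S.SameState (j + m) (i + m) := by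
  have hl : (1 : ℤ) ≤ S.length := by exact_mod_cast S.length_pos
  have hm : 0 ≤ m + S.length * |m| := by nlinarith [neg_abs_le m, abs_nonneg m]
  have := h.add_nat (m + S.length * |m|).toNat
  rw [Int.toNat_of_nonneg hm, ← add_assoc, ← add_assoc] at this
  exact this.shift

/-- If every edge class has an odd number of hits, then the trajectory, before it repeats itself,
passes each edge class once more in one direction than in the other, and so winds exactly once around
the cycle of copies. -/
theorem exists_winding (hs : ¬ Even (S.hits 0).card) : S.period ≠ 0 ∧ ∃ m : ℕ, 0 < m ∧ ∃ θ : ℤˣ,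
    ∀ j, S.dir (j + m) = S.dir j ∧ S.refl (j + m) = S.refl j ∧
      S.lev (j + m) = S.lev j + S.period * (θ : ℤ) := by
  classical
  have hex : ∃ m : ℕ, 0 < m ∧ S.SameState 0 m := by
    refine ⟨S.length, S.length_pos, ?_, ?_, ?_⟩
    · simpa using S.dir_add 0
    · simpa using S.pos_add 0
    · simpa using S.lev_add 0
  obtain ⟨m, ⟨hm, hE⟩, hmin⟩ : ∃ m : ℕ, (0 < m ∧ S.SameState 0 m) ∧
      ∀ m' : ℕ, 0 < m' → S.SameState 0 m' → m ≤ m' :=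
    ⟨Nat.find hex, Nat.find_spec hex, fun m' h h' => Nat.find_min' hex ⟨h, h'⟩⟩
  have hper : ∀ j : ℤ, S.SameState j (j + m) := by
    intro j
    have := hE.add j
    rwa [zero_add, add_comm (m : ℤ)] at this
  have hinj : ∀ i < m, ∀ i' < m, S.SameState i i' → i = i' := by
    have key : ∀ i i' : ℕ, i < i' → i' < m → ¬ S.SameState i i' := by
      intro i i' hlt hi' h
      have := h.add (-i)
      rw [add_neg_cancel, ← sub_eq_add_neg, ← Nat.cast_sub hlt.le] at this
      have := hmin (i' - i) (by omega) this
      omega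
    intro i hi i' hi' h
    rcases lt_trichotomy i i' with hlt | rfl | hlt
    · exact absurd h (key i i' hlt hi')
    · rfl
    · exact absurd ⟨h.1.symm, h.2.1.symm, h.2.2.symm⟩ (key i' i hlt hi)
  obtain ⟨θ, hθ⟩ := S.exists_dir_eq_rank
  obtain ⟨F, hF, hF'⟩ := exists_int_floor S.period 0
  have hm' : (0 : ℤ) < m := by exact_mod_cast hm
  have hsmul : ∀ j t : ℤ, S.SameState j (j + m * t) := by
    intro j t
    have h1 : Function.Periodic S.dir (m : ℤ) := fun j => (hper j).1
    have h2 : Function.Periodic S.pos (m : ℤ) := fun j => (hper j).2.1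
    have h3 : Function.Periodic (fun j => S.lev j % (S.period : ℤ)) (m : ℤ) :=
      fun j => (hper j).2.2
    rw [mul_comm]
    exact ⟨h1.int_mul t j, h2.int_mul t j, h3.int_mul t j⟩
  have hedge : ∀ {j i : ℤ}, S.SameState j i → S.edgeAt i ≡ S.edgeAt j [ZMOD S.period] := by
    intro j i h
    rw [edgeAt, edgeAt, h.1]
    exact edgeOf_modEq.2 h.2.2
  have hhits : S.hits 0 = ((Finset.range m).filter
      fun j : ℕ => S.edgeAt j ≡ 0 [ZMOD S.period]).image fun j : ℕ => S.pos j := by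
    ext x
    simp only [mem_hits, Finset.mem_image, Finset.mem_filter, Finset.mem_range]
    constructor
    · rintro ⟨j, h, rfl⟩
      have h0 : ((j % m).toNat : ℤ) = j % m := Int.toNat_of_nonneg (Int.emod_nonneg _ hm'.ne')
      have h2 := Int.emod_lt_of_pos j hm'
      have h3 := hsmul (j % m) (j / m)
      rw [Int.emod_add_mul_ediv] at h3
      refine ⟨(j % m).toNat, ⟨by omega, ?_⟩, ?_⟩
      · rw [h0]
        exact (hedge h3).symm.trans h
      · rw [h0, h3.2.1]
    · rintro ⟨j, ⟨_, h⟩, rfl⟩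
      exact ⟨j, h, rfl⟩
  have hsum : ∑ j ∈ (Finset.range m).filter (fun j : ℕ => S.edgeAt j ≡ 0 [ZMOD S.period]),
      ((S.dir j : ℤˣ) : ℤ) = θ := by
    have h1 := sum_neg_one_pow_rankIn (S.hits 0)
    rw [if_neg hs] at h1
    conv_lhs at h1 => rw [hhits]
    rw [Finset.sum_image, ← hhits] at h1
    · rw [← mul_one (θ : ℤ), ← h1, Finset.mul_sum]
      refine Finset.sum_congr rfl fun j hj => ?_
      rw [Finset.mem_filter] at hj
      rw [hθ, rank, hits_congr hj.2]
      push_cast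
      rfl
    · intro i hi i' hi' h
      simp only [Finset.coe_filter, Finset.mem_range, Set.mem_ofPred_eq] at hi hi'
      have he := hi'.2.trans hi.2.symm
      have hd := dir_congr he h.symm
      refine hinj i hi.1 i' hi'.1 ⟨hd, h.symm, ?_⟩
      rw [edgeAt, edgeAt, hd] at he
      exact edgeOf_modEq.1 he
  have htel : F (S.lev m) - F (S.lev 0) = θ := by
    have h1 := Finset.sum_range_sub (fun j : ℕ => F (S.lev j)) m
    rw [Nat.cast_zero] at h1
    rw [← h1, ← hsum, Finset.sum_filter]
    refine Finset.sum_congr rfl fun j _ => ?_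
    push_cast
    rw [S.lev_succ]
    rcases Int.units_eq_one_or (S.dir j) with h | h
    · have := hF (S.lev j)
      simp only [edgeAt, edgeOf, h]
      simpa using this
    · have := hF (S.lev j - 1)
      rw [sub_add_cancel] at this
      simp only [edgeAt, edgeOf, h]
      split_ifs at this ⊢ <;> simp_all [← sub_eq_add_neg]
      all_goals omega
  obtain ⟨t, ht⟩ := Int.modEq_iff_dvd.1 (hper 0).2.2.symm
  rw [zero_add] at ht
  have ht' : S.lev m = S.lev 0 + S.period * t := by linarith
  rw [ht', hF'] at htel
  have hp : S.period ≠ 0 := by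
    intro h
    rw [if_pos h] at htel
    exact θ.ne_zero htel.symm
  rw [if_neg hp] at htel
  subst htel
  refine ⟨hp, m, hm, θ, fun j => ⟨(hper j).1, (hper j).step.2, ?_⟩⟩
  induction j using Int.induction_on with
  | zero => simpa using ht'
  | succ i ih =>
    rw [show (i : ℤ) + 1 + m = i + m + 1 by ring, S.lev_succ, S.lev_succ, ih, (hper i).1]
    ring
  | pred i ih =>
    have h1 := S.lev_succ (-i - 1)
    have h2 := S.lev_succ (-i - 1 + m)
    rw [sub_add_cancel] at h1
    rw [show -(i : ℤ) - 1 + m + 1 = -i + m by ring, (hper _).1] at h2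
    linarith

end ChordSystem

/-! ### Integer sequences -/

theorem exists_antiderivative (δ : ℤ → ℤ) : ∃ κ : ℤ → ℤ, κ 0 = 0 ∧ ∀ j, κ (j + 1) = κ j + δ j := by
  refine ⟨fun j => ∑ i ∈ Finset.range j.toNat, δ i - ∑ i ∈ Finset.range (-j).toNat, δ (-i - 1),
    by simp, fun j => ?_⟩
  rcases le_or_gt 0 j with h | h
  · obtain ⟨k, rfl⟩ := Int.eq_ofNat_of_zero_le h
    have h1 : ((k : ℤ) + 1).toNat = k + 1 := by omega
    have h2 : (-(k : ℤ)).toNat = 0 := by omega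
    have h3 : (-((k : ℤ) + 1)).toNat = 0 := by omega
    simp only [h1, h2, h3, Int.toNat_natCast, Finset.sum_range_succ, Finset.sum_range_zero]
    ring
  · obtain ⟨k, hk⟩ := Int.eq_ofNat_of_zero_le (a := -j - 1) (by omega)
    obtain rfl : j = -k - 1 := by omega
    have h1 : (-(k : ℤ) - 1 + 1).toNat = 0 := by omega
    have h2 : (-(-(k : ℤ) - 1 + 1)).toNat = k := by omega
    have h3 : (-(k : ℤ) - 1).toNat = 0 := by omega
    have h4 : (-(-(k : ℤ) - 1)).toNat = k + 1 := by omega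
    simp only [h1, h2, h3, h4, Finset.sum_range_succ, Finset.sum_range_zero]
    ring

/-- A set of reals that is invariant under translation by `L > 0`, with finitely many elements (but
at least one) in `[0, L)`, is the range of an increasing sequence that advances by `L` each `n`
steps. -/
theorem exists_enumeration {s : Set ℝ} {L : ℝ} (hL : 0 < L) (hs : ∀ t, t + L ∈ s ↔ t ∈ s) {n : ℕ}
    (hn : 0 < n) (τ : Fin n → ℝ) (hτ : StrictMono τ)
    (hr : Set.range τ = {t | t ∈ Set.Ico 0 L ∧ t ∈ s}) :
    ∃ T : ℤ → ℝ, StrictMono T ∧ Set.range T = s ∧ (∀ i, T (i + n) = T i + L) ∧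
      ∀ i : Fin n, T (i : ℕ) = τ i := by
  have hn' : (0 : ℤ) < n := by exact_mod_cast hn
  have hmod : ∀ i : ℤ, (i % n).toNat < n := fun i => by
    have h1 := Int.emod_nonneg i hn'.ne'
    have h2 := Int.emod_lt_of_pos i hn'
    omega
  have hI : ∀ i, τ i ∈ Set.Ico 0 L ∧ τ i ∈ s := fun i => by
    have : τ i ∈ Set.range τ := ⟨i, rfl⟩
    rwa [hr] at this
  have hsm : ∀ (t : ℝ) (k : ℤ), t + L * k ∈ s ↔ t ∈ s := by
    intro t k
    induction k using Int.induction_on with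
    | zero => simp
    | succ i ih =>
      rw [← ih, ← hs (t + L * (i : ℤ))]
      push_cast
      rw [show t + L * (i + 1) = t + L * i + L by ring]
    | pred i ih =>
      rw [← ih, ← hs]
      push_cast
      rw [show t + L * (-i - 1) + L = t + L * -i by ring]
  refine ⟨fun i => τ ⟨(i % n).toNat, hmod i⟩ + L * (i / n : ℤ), ?_, ?_, ?_, ?_⟩
  · intro i j hij
    have hq : i / n ≤ j / n := Int.ediv_le_ediv hn' hij.le
    rcases hq.lt_or_eq with hq | hq
    · have h1 : ((i / n : ℤ) : ℝ) + 1 ≤ (j / n : ℤ) := by exact_mod_cast hq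
      have h2 := (hI ⟨(i % n).toNat, hmod i⟩).1.2
      have h3 := (hI ⟨(j % n).toNat, hmod j⟩).1.1
      simp only
      nlinarith
    · have h1 := Int.emod_add_mul_ediv i n
      have h2 := Int.emod_add_mul_ediv j n
      rw [hq] at h1
      have h3 := Int.emod_nonneg i hn'.ne'
      have h4 : τ ⟨(i % n).toNat, hmod i⟩ < τ ⟨(j % n).toNat, hmod j⟩ := by
        apply hτ
        rw [Fin.mk_lt_mk]
        omega
      simp only [hq]
      linarith
  · ext t
    constructor
    · rintro ⟨i, rfl⟩
      exact (hsm _ _).2 (hI _).2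
    · intro ht
      have h1 : t - L * ⌊t / L⌋ ∈ Set.range τ := by
        rw [hr]
        refine ⟨⟨?_, ?_⟩, ?_⟩
        · have := Int.floor_le (t / L)
          rw [le_div_iff₀ hL] at this
          linarith
        · have := Int.lt_floor_add_one (t / L)
          rw [div_lt_iff₀ hL] at this
          linarith
        · rw [← hsm _ ⌊t / L⌋]
          simpa using ht
      obtain ⟨i, hi⟩ := h1
      refine ⟨i + n * ⌊t / L⌋, ?_⟩
      have h2 : ((i : ℕ) + n * ⌊t / L⌋ : ℤ) % n = i := by
        rw [Int.add_mul_emod_self_left, Int.emod_eq_of_lt (by omega) (by exact_mod_cast i.2)]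
      have h3 : ((i : ℕ) + n * ⌊t / L⌋ : ℤ) / n = ⌊t / L⌋ := by
        rw [Int.add_mul_ediv_left _ _ hn'.ne', Int.ediv_eq_zero_of_lt (by omega)
          (by exact_mod_cast i.2), zero_add]
      simp only [h2, h3, Int.toNat_natCast, Fin.eta, hi]
      ring
  · intro i
    have h1 : (i + n) / (n : ℤ) = i / n + 1 := Int.add_ediv_of_dvd_right (dvd_refl _) |>.trans
      (by rw [Int.ediv_self hn'.ne'])
    simp only [Int.add_emod_right, h1]
    push_cast
    ring
  · intro i
    have h2 : ((i : ℕ) : ℤ) % n = i := Int.emod_eq_of_lt (by omega) (by exact_mod_cast i.2)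
    have h3 : ((i : ℕ) : ℤ) / n = 0 := Int.ediv_eq_zero_of_lt (by omega) (by exact_mod_cast i.2)
    simp [h2, h3]

/-- The solutions of a periodic predicate on the integers can be listed in increasing order. -/
theorem exists_int_enumeration {P : ℤ → Prop} {n : ℕ} (hn : 0 < n) (hP : ∀ i, P (i + n) ↔ P i)
    (hex : ∃ i, P i) : ∃ (N : ℕ) (e : ℤ → ℤ), 0 < N ∧ StrictMono e ∧ (∀ i, P i ↔ ∃ j, e j = i) ∧
      ∀ j, e (j + N) = e j + n := by
  classical
  have hn' : (0 : ℤ) < n := by exact_mod_cast hn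
  set A : Finset ℤ := (Finset.Ico (0 : ℤ) n).filter P with hA
  have hAne : 0 < A.card := by
    obtain ⟨i, hi⟩ := hex
    refine Finset.card_pos.2 ⟨i % n, ?_⟩
    rw [hA, Finset.mem_filter, Finset.mem_Ico]
    refine ⟨⟨Int.emod_nonneg _ hn'.ne', Int.emod_lt_of_pos _ hn'⟩, ?_⟩
    have h : Function.Periodic P (n : ℤ) := fun i => propext (hP i)
    have := h.int_mul (i / n) (i % n)
    rw [mul_comm, Int.cast_id, Int.emod_add_mul_ediv] at this
    rwa [← this]
  have hs : ∀ t : ℝ, t + (n : ℝ) ∈ {t : ℝ | ∃ i : ℤ, P i ∧ (i : ℝ) = t} ↔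
      t ∈ {t : ℝ | ∃ i : ℤ, P i ∧ (i : ℝ) = t} := by
    intro t
    constructor
    · rintro ⟨i, hi, h⟩
      refine ⟨i - n, ?_, by push_cast; linarith⟩
      rw [← hP, sub_add_cancel]
      exact hi
    · rintro ⟨i, hi, h⟩
      exact ⟨i + n, (hP i).2 hi, by push_cast; linarith⟩
  obtain ⟨T, hT, hTr, hTn, -⟩ := exists_enumeration (s := {t : ℝ | ∃ i : ℤ, P i ∧ (i : ℝ) = t})
    (L := n) (by exact_mod_cast hn) hs hAne (fun i => ((A.orderEmbOfFin rfl i : ℤ) : ℝ))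
    (fun i j h => Int.cast_lt.2 ((A.orderEmbOfFin rfl).strictMono h)) (by
      ext t
      constructor
      · rintro ⟨i, rfl⟩
        have := Finset.mem_filter.1 (A.orderEmbOfFin_mem rfl i)
        rw [Finset.mem_Ico] at this
        refine ⟨⟨?_, ?_⟩, _, this.2, rfl⟩ <;> beta_reduce
        exacts [by exact_mod_cast this.1.1, by exact_mod_cast this.1.2]
      · rintro ⟨⟨h1, h2⟩, i, hi, rfl⟩
        have : i ∈ A := by
          rw [hA, Finset.mem_filter, Finset.mem_Ico]
          exact ⟨⟨by exact_mod_cast h1, by exact_mod_cast h2⟩, hi⟩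
        rw [← Finset.mem_coe, ← A.range_orderEmbOfFin rfl] at this
        obtain ⟨j, hj⟩ := this
        exact ⟨j, by simp only [hj]⟩)
  have hmem : ∀ j, ∃ i : ℤ, P i ∧ (i : ℝ) = T j := fun j => by
    have : T j ∈ Set.range T := ⟨j, rfl⟩
    rwa [hTr] at this
  choose e he heT using hmem
  refine ⟨A.card, e, hAne, fun i j h => ?_, fun i => ⟨fun hi => ?_, ?_⟩, fun j => ?_⟩
  · have := hT h
    rw [← heT, ← heT] at this
    exact_mod_cast this
  · have : (i : ℝ) ∈ Set.range T := by rw [hTr]; exact ⟨i, hi, rfl⟩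
    obtain ⟨j, hj⟩ := this
    rw [← heT] at hj
    exact ⟨j, by exact_mod_cast hj⟩
  · rintro ⟨j, rfl⟩
    exact he j
  · have := hTn j
    rw [← heT, ← heT] at this
    exact_mod_cast this

/-! ### Paths in the normalised triangle -/

open ComplexConjugate in
/-- The linear parts of the reflections in the edges of the triangle `-1`, `1`, `c i`, where
`ζ = exp (2 i β)` for the base angle `β`.  Edge `0` is the base, edge `1` ends at `1`, edge `2` ends
at `-1`. -/
noncomputable def dirRefl (ζ : ℂ) (i : Fin 3) (u : ℂ) : ℂ :=
  ![conj u, ζ⁻¹ * conj u, ζ * conj u] i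

/-- Affine functions that vanish on the edges of the triangle `-1`, `1`, `c i` and are positive
inside. -/
noncomputable def height (c : ℝ) (i : Fin 3) (z : ℂ) : ℝ :=
  ![z.im, c - c * z.re - z.im, c + c * z.re - z.im] i

/-- Exchange of the two legs of the isosceles triangle. -/
def swapLegs : Fin 3 → Fin 3 := ![0, 2, 1]

/-- The successive hits of a periodic billiard trajectory in the triangle `-1`, `1`, `c i`: the `i`-th
hit is at the point `p i` of the edge `y i`, and the trajectory leaves it with velocity `v i` to reach
the next one after time `τ i`.  The midpoint `0` of the base is avoided. -/
structure HitSequence (c : ℝ) (ζ : ℂ) where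
  n : ℕ
  n_pos : 0 < n
  y : ℤ → Fin 3
  p : ℤ → ℂ
  v : ℤ → ℂ
  τ : ℤ → ℝ
  τ_pos : ∀ i, 0 < τ i
  v_ne_zero : ∀ i, v i ≠ 0
  p_succ : ∀ i, p (i + 1) = p i + τ i • v i
  v_succ : ∀ i, v (i + 1) = dirRefl ζ (y (i + 1)) (v i)
  on_edge : ∀ i, height c (y i) (p i) = 0
  off_edge : ∀ i j, j ≠ y i → 0 < height c j (p i)
  y_succ_ne : ∀ i, y (i + 1) ≠ y i
  p_ne_zero : ∀ i, p i ≠ 0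
  y_add : ∀ i, y (i + n) = y i
  p_add : ∀ i, p (i + n) = p i
  v_add : ∀ i, v (i + n) = v i

/-- `z` if `s = 1`, the conjugate of `z` if `s = -1`. -/
def conjBy (s : ℤˣ) (z : ℂ) : ℂ := ⟨z.re, ((s : ℤ) : ℝ) * z.im⟩

@[simp] theorem conjBy_re (s : ℤˣ) (z : ℂ) : (conjBy s z).re = z.re := rfl

@[simp] theorem conjBy_im (s : ℤˣ) (z : ℂ) : (conjBy s z).im = ((s : ℤ) : ℝ) * z.im := rfl

open ComplexConjugate in
theorem conjBy_neg (s : ℤˣ) (z : ℂ) : conjBy (-s) z = conjBy s (conj z) := by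
  apply Complex.ext <;> simp

open ComplexConjugate in
/-- Conjugating with alternating signs turns the reflections in the legs into rotations. -/
theorem conjBy_dirRefl {ζ : ℂ} (hζ : ‖ζ‖ = 1) (s : ℤˣ) {i : Fin 3} (hi : i ≠ 0) (u : ℂ) :
    conjBy (-s) (dirRefl ζ i u) =
      ζ ^ ((s * (if i = 1 then 1 else -1) : ℤˣ) : ℤ) * conjBy s u := by
  have hinv : ζ⁻¹ = conj ζ := Complex.inv_eq_conj hζ
  have h1 : conj ζ⁻¹ = ζ := by rw [hinv, Complex.conj_conj]
  fin_cases i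
  · exact absurd rfl hi
  · rw [conjBy_neg]
    rcases Int.units_eq_one_or s with rfl | rfl
    · apply Complex.ext <;> simp [dirRefl, hinv]
    · apply Complex.ext <;> simp [dirRefl, hinv]; ring
  · rw [conjBy_neg]
    rcases Int.units_eq_one_or s with rfl | rfl
    · apply Complex.ext <;> simp [dirRefl, hinv]
    · apply Complex.ext <;> simp [dirRefl, hinv]; ring

namespace HitSequence

variable {c : ℝ} {ζ : ℂ} (H : HitSequence c ζ)

theorem y_add_mul (i t : ℤ) : H.y (i + H.n * t) = H.y i := by
  have h : Function.Periodic H.y (H.n : ℤ) := H.y_add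
  have := h.int_mul t i
  rwa [mul_comm] at this

theorem p_add_mul (i t : ℤ) : H.p (i + H.n * t) = H.p i := by
  have h : Function.Periodic H.p (H.n : ℤ) := H.p_add
  have := h.int_mul t i
  rwa [mul_comm] at this

theorem v_add_mul (i t : ℤ) : H.v (i + H.n * t) = H.v i := by
  have h : Function.Periodic H.v (H.n : ℤ) := H.v_add
  have := h.int_mul t i
  rwa [mul_comm] at this

/-- The velocity after the `i`-th hit, with the reflections in the base undone. -/
noncomputable def dirAfter (i : ℤ) : ℂ := conjBy (i + 1).negOnePow (H.v i)

theorem dirAfter_of_base {i : ℤ} (h : H.y (i + 1) = 0) : H.dirAfter (i + 1) = H.dirAfter i := by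
  rw [dirAfter, dirAfter, H.v_succ, h, Int.negOnePow_succ, conjBy_neg]
  simp [dirRefl]

theorem dirAfter_of_leg (hζ : ‖ζ‖ = 1) {i : ℤ} (h : H.y (i + 1) ≠ 0) : H.dirAfter (i + 1) =
    ζ ^ (((i + 1).negOnePow * (if H.y (i + 1) = 1 then 1 else -1) : ℤˣ) : ℤ) * H.dirAfter i := by
  rw [dirAfter, dirAfter, H.v_succ, Int.negOnePow_succ (i + 1), conjBy_dirRefl hζ _ h]

variable {H}

theorem exists_leg : ∃ i, H.y i ≠ 0 := by
  by_contra! h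
  exact H.y_succ_ne 0 ((h _).trans (h _).symm)

theorem im_base {i : ℤ} (h : H.y i = 0) : (H.p i).im = 0 := by
  have := H.on_edge i
  rw [h] at this
  exact this

theorem leg_cases {i : Fin 3} (h : i ≠ 0) : i = 1 ∨ i = 2 := by
  fin_cases i <;> simp_all

variable (H) in
/-- The leg hits of a hit sequence: `e` lists their indices in increasing order. -/
structure LegIndex (e : ℤ → ℤ) (N : ℕ) : Prop where
  N_pos : 0 < N
  strictMono : StrictMono e
  leg_iff : ∀ i, H.y i ≠ 0 ↔ ∃ j, e j = i
  add : ∀ j, e (j + N) = e j + H.n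

variable (H) in
theorem exists_legIndex : ∃ e N, H.LegIndex e N := by
  obtain ⟨N, e, h1, h2, h3, h4⟩ := exists_int_enumeration (P := fun i => H.y i ≠ 0) H.n_pos
    (fun i => by rw [H.y_add]) exists_leg
  exact ⟨e, N, h1, h2, h3, h4⟩

theorem LegIndex.succ {e : ℤ → ℤ} {N : ℕ} (he : H.LegIndex e N) (j : ℤ) :
    (e (j + 1) = e j + 1 ∧ H.y (e j + 1) ≠ 0) ∨ (e (j + 1) = e j + 2 ∧ H.y (e j + 1) = 0) := by
  have hlt : e j < e (j + 1) := he.strictMono (by omega)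
  have hmin : ∀ i, e j < i → H.y i ≠ 0 → e (j + 1) ≤ i := by
    intro i hi hy
    obtain ⟨k, rfl⟩ := (he.leg_iff i).1 hy
    exact he.strictMono.monotone (he.strictMono.lt_iff_lt.1 hi)
  have hleg : H.y (e (j + 1)) ≠ 0 := (he.leg_iff _).2 ⟨_, rfl⟩
  by_cases h : H.y (e j + 1) = 0
  · right
    have h2 : H.y (e j + 2) ≠ 0 := by
      have := H.y_succ_ne (e j + 1)
      rwa [h, add_assoc] at this
    have h3 := hmin (e j + 2) (by omega) h2
    have h4 : e (j + 1) ≠ e j + 1 := by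
      intro h'
      rw [h'] at hleg
      exact hleg h
    exact ⟨by omega, h⟩
  · left
    have := hmin (e j + 1) (by omega) h
    exact ⟨by omega, h⟩

variable (H) in
/-- `1` if the hit `i` is on the leg that ends at `1`, else `-1`. -/
def side (i : ℤ) : ℤˣ := if H.y i = 1 then 1 else -1

theorem re_of_leg {i : ℤ} (hc : 0 < c) (h : H.y i ≠ 0) :
    (H.p i).re = ((H.side i : ℤ) : ℝ) * (1 - (H.p i).im / c) := by
  have h1 := H.on_edge i
  rcases leg_cases h with hy | hy <;> rw [hy] at h1 <;> simp [height] at h1 <;> simp [side, hy] <;>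
    field_simp <;> linarith

theorem im_of_leg {i : ℤ} (hc : 0 < c) (h : H.y i ≠ 0) :
    (H.p i).im / c ∈ Set.Ioo (0 : ℝ) 1 := by
  have h1 := H.on_edge i
  have h0 := H.off_edge i 0 h.symm
  have h2 := H.off_edge i 1
  have h3 := H.off_edge i 2
  constructor
  · exact div_pos h0 hc
  · rw [div_lt_one hc]
    rcases leg_cases h with hy | hy <;> rw [hy] at h1 h2 h3 <;> simp [height] at h1 h2 h3 <;> linarith

/-- The linear functional whose level lines have direction `u`. -/
def transverse (u z : ℂ) : ℝ := u.re * z.im - u.im * z.re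

theorem transverse_leg {i : ℤ} (hc : 0 < c) (h : H.y i ≠ 0) (u : ℂ) (s : ℤˣ) :
    transverse u (conjBy s (H.p i)) =
      ((s : ℤ) : ℝ) * edgeValue (-u.im) (c * u.re) (s * H.side i) ((H.p i).im / c) := by
  rw [transverse, conjBy_re, conjBy_im, re_of_leg hc h, edgeValue]
  rcases Int.units_eq_one_or s with rfl | rfl <;> push_cast <;> field_simp <;> ring

theorem transverse_succ (i : ℤ) : transverse (H.dirAfter i) (conjBy (i + 1).negOnePow (H.p (i + 1)))
    = transverse (H.dirAfter i) (conjBy (i + 1).negOnePow (H.p i)) := by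
  rw [H.p_succ, dirAfter]
  simp [transverse]
  ring

theorem transverse_base {i : ℤ} (h : H.y i = 0) (u : ℂ) (s : ℤˣ) :
    transverse u (conjBy s (H.p i)) = transverse u (conjBy (-s) (H.p i)) := by
  simp [transverse, im_base h]

theorem LegIndex.dirAfter_succ {e : ℤ → ℤ} {N : ℕ} (he : H.LegIndex e N) (j : ℤ) :
    H.dirAfter (e (j + 1) - 1) = H.dirAfter (e j) := by
  rcases he.succ j with ⟨h1, h2⟩ | ⟨h1, h2⟩
  · rw [h1, add_sub_cancel_right]
  · rw [h1, ← H.dirAfter_of_base h2]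
    congr 1
    ring

theorem LegIndex.refl_eq {e : ℤ → ℤ} {N : ℕ} (he : H.LegIndex e N) (j : ℤ) :
    (-(e j).negOnePow * (e (j + 1)).negOnePow = 1 ∧ e (j + 1) = e j + 1) ∨
    (-(e j).negOnePow * (e (j + 1)).negOnePow = -1 ∧ e (j + 1) = e j + 2) := by
  rcases he.succ j with ⟨h1, h2⟩ | ⟨h1, h2⟩
  · left
    rw [h1, Int.negOnePow_succ, neg_mul_neg, Int.units_mul_self]
    exact ⟨rfl, rfl⟩
  · right
    rw [h1, Int.negOnePow_add, Int.negOnePow_even 2 (by decide)]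
    simp

/-- The direction of an incoming trajectory determines, for a given direction of passage through
the sheets, whether the trajectory is seen directly or conjugated. -/
theorem sign_pos {i : ℤ} (h : H.y (i + 1) ≠ 0) :
    0 < (((i + 1).negOnePow : ℤ) : ℝ) * ((((i + 1).negOnePow * H.side (i + 1) : ℤˣ) : ℤ) *
      (c * (H.dirAfter i).re) + (H.dirAfter i).im) := by
  have h1 := H.on_edge (i + 1)
  have h2 := H.off_edge i _ (H.y_succ_ne i)
  have h3 : H.p i = H.p (i + 1) - H.τ i • H.v i := by rw [H.p_succ, add_sub_cancel_right]
  rw [h3] at h2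
  have hpos : 0 < ((H.side (i + 1) : ℤ) : ℝ) * (c * (H.v i).re) + (H.v i).im := by
    have ht := H.τ_pos i
    rcases leg_cases h with hy | hy <;> rw [hy] at h1 h2 <;> simp [height] at h1 h2 <;>
      simp [side, hy] <;> by_contra! hcon <;> nlinarith
  rw [dirAfter, conjBy_re, conjBy_im]
  rcases Int.units_eq_one_or (i + 1).negOnePow with hs | hs <;> rw [hs] <;> push_cast <;> linarith

theorem dirAfter_ne_zero (i : ℤ) : H.dirAfter i ≠ 0 := by
  intro h
  apply H.v_ne_zero i
  have h1 := congrArg Complex.re h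
  have h2 := congrArg Complex.im h
  rw [dirAfter, conjBy_re, Complex.zero_re] at h1
  rw [dirAfter, conjBy_im, Complex.zero_im] at h2
  apply Complex.ext h1
  rcases Int.units_eq_one_or (i + 1).negOnePow with hs | hs <;> rw [hs] at h2 <;> simpa using h2

/-- The direction before a leg hit is rotated by a power of `ζ`, the exponent being the number of
the sheet. -/
theorem LegIndex.dirAfter_eq (hζ : ‖ζ‖ = 1) {e : ℤ → ℤ} {N : ℕ} (he : H.LegIndex e N) {κ : ℤ → ℤ}
    (h0 : κ 0 = 0)
    (hκ : ∀ j, κ (j + 1) = κ j + (((e j).negOnePow * H.side (e j) : ℤˣ) : ℤ)) (j : ℤ) :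
    H.dirAfter (e j - 1) = ζ ^ κ j * H.dirAfter (e 0 - 1) := by
  have hζ0 : ζ ≠ 0 := by
    rintro rfl
    simp at hζ
  have hstep : ∀ j, H.dirAfter (e (j + 1) - 1) =
      ζ ^ (((e j).negOnePow * H.side (e j) : ℤˣ) : ℤ) * H.dirAfter (e j - 1) := by
    intro j
    have hl : H.y (e j - 1 + 1) ≠ 0 := by
      rw [sub_add_cancel]
      exact (he.leg_iff _).2 ⟨_, rfl⟩
    rw [he.dirAfter_succ]
    have := H.dirAfter_of_leg hζ hl
    rw [sub_add_cancel] at this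
    exact this
  induction j using Int.induction_on with
  | zero => simp [h0]
  | succ i ih => rw [hstep, ih, hκ, zpow_add₀ hζ0]; ring
  | pred i ih =>
    have h1 := hstep (-i - 1)
    have h2 := hκ (-i - 1)
    rw [sub_add_cancel] at h1 h2
    rw [ih, h2, zpow_add₀ hζ0] at h1
    have : ζ ^ (((e (-i - 1)).negOnePow * H.side (e (-i - 1)) : ℤˣ) : ℤ) ≠ 0 := zpow_ne_zero _ hζ0
    apply mul_left_cancel₀ this
    rw [← h1]
    ring

/-- The trajectory, unfolded in the base, is a trajectory in a rhombus. -/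
theorem LegIndex.exists_chordSystem (hc : 0 < c) (hζ : ‖ζ‖ = 1) {m : ℕ}
    (hm : ∀ k : ℤ, ζ ^ k = 1 → (m : ℤ) ∣ k) (hm' : m = 0 ∨ ζ ^ m = -1)
    {e : ℤ → ℤ} {N : ℕ} (he : H.LegIndex e N) : ∃ S : ChordSystem, S.period = m ∧
      (∀ j, S.dir j = (e j).negOnePow * H.side (e j)) ∧
      (∀ j, S.refl j = -(e j).negOnePow * (e (j + 1)).negOnePow) ∧
      ∀ j, H.dirAfter (e j - 1) = ζ ^ S.lev j * H.dirAfter (e 0 - 1) := by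
  have hζ0 : ζ ≠ 0 := by
    rintro rfl
    simp at hζ
  obtain ⟨κ, hκ0, hκ⟩ := exists_antiderivative fun j => (((e j).negOnePow * H.side (e j) : ℤˣ) : ℤ)
  have hdir := he.dirAfter_eq hζ hκ0 hκ
  set Ψ := H.dirAfter (e 0 - 1) with hΨ
  have hΨ0 : Ψ ≠ 0 := H.dirAfter_ne_zero _
  have hleg : ∀ j, H.y (e j) ≠ 0 := fun j => (he.leg_iff _).2 ⟨_, rfl⟩
  have hadd : ∀ j, e (j + (2 * N : ℕ)) = e j + H.n * 2 := by
    intro j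
    have : j + ((2 * N : ℕ) : ℤ) = j + N + N := by push_cast; ring
    rw [this, he.add, he.add]
    ring
  have hη : ∀ j, (e (j + (2 * N : ℕ))).negOnePow = (e j).negOnePow := by
    intro j
    rw [hadd, Int.negOnePow_add, mul_comm (H.n : ℤ), Int.negOnePow_two_mul, mul_one]
  have hside : ∀ j, H.side (e (j + (2 * N : ℕ))) = H.side (e j) := by
    intro j
    rw [side, side, hadd, H.y_add_mul]
  have hlast : ∀ j, H.dirAfter (e j) = ζ ^ κ (j + 1) * Ψ := by
    intro j
    rw [← he.dirAfter_succ, hdir]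
  refine ⟨{
    period := m
    α := fun k => -(ζ ^ k * Ψ).im
    γ := fun k => c * (ζ ^ k * Ψ).re
    ne_zero := ?_
    proportional := ?_
    pos := fun j => (H.p (e j)).im / c
    pos_mem := fun j => im_of_leg hc (hleg j)
    dir := fun j => (e j).negOnePow * H.side (e j)
    refl := fun j => -(e j).negOnePow * (e (j + 1)).negOnePow
    lev := κ
    lev_succ := hκ
    chord := ?_
    fold := ?_
    length := 2 * N
    length_pos := Nat.mul_pos two_pos he.N_pos
    pos_add := fun j => by rw [hadd, H.p_add_mul]
    dir_add := fun j => by rw [hη, hside]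
    lev_add := ?_ }, rfl, fun _ => rfl, fun _ => rfl, hdir⟩
  · intro k
    by_contra! h
    apply mul_ne_zero (zpow_ne_zero k hζ0) hΨ0
    apply Complex.ext
    · simpa [hc.ne'] using h.2
    · exact neg_eq_zero.1 h.1
  · intro k
    rcases hm' with rfl | hm'
    · exact ⟨1, by simp⟩
    · refine ⟨-1, ?_⟩
      rw [zpow_add₀ hζ0, zpow_natCast, hm']
      exact ⟨by simp, by simp; ring⟩
  · intro j
    rw [← hlast]
    have h1 := transverse_leg hc (hleg j) (H.dirAfter (e j)) (-(e j).negOnePow)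
    have h2 := transverse_leg hc (hleg (j + 1)) (H.dirAfter (e j)) (e (j + 1)).negOnePow
    have h3 : transverse (H.dirAfter (e j)) (conjBy (-(e j).negOnePow) (H.p (e j))) =
        transverse (H.dirAfter (e j)) (conjBy (e (j + 1)).negOnePow (H.p (e (j + 1)))) := by
      have hs := H.transverse_succ (e j)
      rw [Int.negOnePow_succ] at hs
      rw [← hs]
      rcases he.succ j with ⟨h1, h2⟩ | ⟨h1, h2⟩
      · rw [h1, Int.negOnePow_succ]
      · have hs' := H.transverse_succ (e j + 1)
        rw [H.dirAfter_of_base h2, Int.negOnePow_succ, Int.negOnePow_succ, neg_neg] at hs'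
        rw [transverse_base h2, neg_neg, ← hs', h1, Int.negOnePow_add,
          Int.negOnePow_even 2 (by decide), mul_one, add_assoc, one_add_one_eq_two]
    rw [h1, h2] at h3
    rw [← neg_mul] 
    rcases Int.units_eq_one_or (e j).negOnePow with ha | ha <;>
      rcases Int.units_eq_one_or (e (j + 1)).negOnePow with hb | hb <;>
      rw [ha, hb] at h3 <;> rw [ha, hb] <;> simp at h3 ⊢ <;> linarith
  · intro j hj
    rcases he.succ j with ⟨h1, h2⟩ | ⟨h1, h2⟩
    · exfalso
      rw [h1, Int.negOnePow_succ, neg_mul, neg_inj] at hj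
      have hs := mul_left_cancel hj
      apply H.y_succ_ne (e j)
      rcases leg_cases (hleg j) with ha | ha <;> rcases leg_cases h2 with hb | hb <;>
        simp [side, ha, hb] at hs ⊢
    · have hηη : (e (j + 1)).negOnePow = (e j).negOnePow := by
        rw [h1, Int.negOnePow_add, Int.negOnePow_even 2 (by decide), mul_one]
      rw [hηη, ← mul_neg] at hj
      have hs := mul_left_cancel hj
      refine ⟨by simp [hηη], fun hpos => H.p_ne_zero (e j + 1) ?_⟩
      -- A chord between opposite points of the rhombus would pass through its centre.
      have e1 := H.p_succ (e j)
      have e2 := H.p_succ (e j + 1)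
      have e3 := H.v_succ (e j)
      have e4 := im_base h2
      have e5 := re_of_leg hc (hleg j)
      have e6 := re_of_leg hc (hleg (j + 1))
      have e7 := (im_of_leg hc (hleg j)).1
      rw [hpos, hs] at e6
      rw [add_assoc, one_add_one_eq_two, ← h1] at e2
      rw [h2] at e3
      have hre : (H.p (e (j + 1))).re = -(H.p (e j)).re := by rw [e5, e6]; push_cast; ring
      have him : (H.p (e (j + 1))).im = (H.p (e j)).im := by
        rwa [div_left_inj' hc.ne'] at hpos
      have him0 : 0 < (H.p (e j)).im := by
        have := mul_pos e7 hc
        rwa [div_mul_cancel₀ _ hc.ne'] at this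
      have f1 := congrArg Complex.re e1
      have f2 := congrArg Complex.im e1
      have f3 := congrArg Complex.re e2
      have f4 := congrArg Complex.im e2
      simp only [e3, dirRefl, Matrix.cons_val_zero, Complex.add_re, Complex.add_im,
        Complex.real_smul, Complex.re_ofReal_mul, Complex.im_ofReal_mul, Complex.conj_re,
        Complex.conj_im] at f1 f2 f3 f4
      have hv : (H.v (e j)).im ≠ 0 := by
        intro h
        rw [h] at f2
        linarith
      have hτ : H.τ (e j) = H.τ (e j + 1) := by
        apply mul_right_cancel₀ hv
        linarith
      apply Complex.ext
      · rw [← hτ] at f3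
        rw [Complex.zero_re]
        linarith
      · exact e4
  · intro j
    have h1 := hdir (j + (2 * N : ℕ))
    have h2 : H.dirAfter (e (j + (2 * N : ℕ)) - 1) = H.dirAfter (e j - 1) := by
      rw [dirAfter, dirAfter, hadd, show e j + H.n * 2 - 1 = e j - 1 + H.n * 2 by ring,
        H.v_add_mul, sub_add_cancel, show e j - 1 + H.n * 2 + 1 = e j + 2 * H.n by ring,
        Int.negOnePow_add, Int.negOnePow_two_mul, mul_one]
    rw [h2, hdir j] at h1
    have h3 := mul_right_cancel₀ hΨ0 h1
    have h4 := hm (κ (j + (2 * N : ℕ)) - κ j) (by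
      rw [zpow_sub₀ hζ0, ← h3, div_self (zpow_ne_zero _ hζ0)])
    exact (Int.modEq_iff_dvd.2 h4).symm

end HitSequence

/-! ### Mirror symmetry of the hits -/

namespace HitSequence

variable {c : ℝ} {ζ : ℂ} {H : HitSequence c ζ}

theorem y_eq_swapLegs {i i' : ℤ} (h : H.y i ≠ 0) (h' : H.y i' ≠ 0) (hs : H.side i' = -H.side i) :
    H.y i' = swapLegs (H.y i) := by
  rcases leg_cases h with ha | ha <;> rcases leg_cases h' with hb | hb <;>
    simp [side, ha, hb, swapLegs] at hs ⊢

/-- A trajectory in an isosceles triangle that avoids the midpoint of the base has the same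
hits as its mirror image, in the opposite or in the same order. -/
theorem exists_symmetry (hc : 0 < c) (hζ : ‖ζ‖ = 1) {m : ℕ}
    (hm : ∀ k : ℤ, ζ ^ k = 1 → (m : ℤ) ∣ k) (hm' : m = 0 ∨ ζ ^ m = -1) :
    (∃ q, ∀ i, H.y (q - i) = swapLegs (H.y i)) ∨ ∃ q, ∀ i, H.y (i + q) = swapLegs (H.y i) := by
  obtain ⟨e, N, he⟩ := H.exists_legIndex
  obtain ⟨S, hSm, hdir, hrefl, hlev⟩ := he.exists_chordSystem hc hζ hm hm'
  have hleg : ∀ j, H.y (e j) ≠ 0 := fun j => (he.leg_iff _).2 ⟨_, rfl⟩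
  -- The number of base hits between consecutive leg hits is read off from `refl`.
  have hgap : ∀ j, e (j + 1) = e j + if S.refl j = 1 then 1 else 2 := by
    intro j
    rw [hrefl]
    rcases he.refl_eq j with ⟨h1, h2⟩ | ⟨h1, h2⟩
    · rw [h1, h2, if_pos rfl]
    · rw [h1, h2, if_neg (by decide)]
  have hσ : ∀ j, H.side (e (j + 1)) = -S.refl j * S.dir j * S.dir (j + 1) * H.side (e j) := by
    intro j
    rw [hrefl, hdir, hdir]
    rcases Int.units_eq_one_or (e j).negOnePow with h1 | h1 <;>
      rcases Int.units_eq_one_or (e (j + 1)).negOnePow with h2 | h2 <;>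
      rcases Int.units_eq_one_or (H.side (e j)) with h3 | h3 <;>
      rcases Int.units_eq_one_or (H.side (e (j + 1))) with h4 | h4 <;>
      rw [h1, h2, h3, h4] <;> decide
  by_cases hev : Even (S.hits 0).card
  · left
    obtain ⟨a, ha, hrev⟩ := ChordSystem.exists_reversal hev
    have hside : ∀ j, H.side (e j) * H.side (e (2 * a + 1 - j)) = -1 := by
      have h0 : H.side (e a) * H.side (e (2 * a + 1 - a)) = -1 := by
        rw [show 2 * a + 1 - a = a + 1 by ring, hσ, ha, (S.fold a ha).1]
        rcases Int.units_eq_one_or (S.dir a) with h1 | h1 <;>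
          rcases Int.units_eq_one_or (H.side (e a)) with h2 | h2 <;> rw [h1, h2] <;> decide
      have hstep : ∀ j, H.side (e (j + 1)) * H.side (e (2 * a + 1 - (j + 1))) =
          H.side (e j) * H.side (e (2 * a + 1 - j)) := by
        intro j
        have h1 := hσ (2 * a - j)
        rw [show 2 * a - j + 1 = 2 * a + 1 - j by ring, (hrev j).1, (hrev j).2] at h1
        have h2 := (hrev (j + 1)).1
        rw [show 2 * a + 1 - (j + 1) = 2 * a - j by ring] at h2 ⊢
        rw [h2] at h1
        rw [h1, hσ]
        rcases Int.units_eq_one_or (S.dir j) with h1 | h1 <;>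
          rcases Int.units_eq_one_or (S.dir (j + 1)) with h2 | h2 <;>
          rcases Int.units_eq_one_or (S.refl j) with h3 | h3 <;>
          rcases Int.units_eq_one_or (H.side (e j)) with h4 | h4 <;>
          rcases Int.units_eq_one_or (H.side (e (2 * a - j))) with h5 | h5 <;>
          rw [h1, h2, h3, h4, h5] <;> decide
      intro j
      rw [← h0]
      induction j using Int.inductionOn' (b := a) with
      | zero => rfl
      | succ k _ ih => rw [hstep, ih]
      | pred k _ ih =>
        have := hstep (k - 1)
        rw [sub_add_cancel] at this
        rw [← this, ih]
    have hsum : ∀ j, e j + e (2 * a + 1 - j) = e 0 + e (2 * a + 1) := by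
      have hstep : ∀ j, e (j + 1) + e (2 * a + 1 - (j + 1)) = e j + e (2 * a + 1 - j) := by
        intro j
        have h1 := hgap j
        have h2 := hgap (2 * a - j)
        rw [show 2 * a - j + 1 = 2 * a + 1 - j by ring, (hrev j).2] at h2
        rw [show 2 * a + 1 - (j + 1) = 2 * a - j by ring]
        linarith
      intro j
      induction j using Int.induction_on with
      | zero => simp
      | succ k ih => rw [hstep, ih]
      | pred k ih =>
        have := hstep (-k - 1)
        rw [sub_add_cancel] at this
        rw [← this, ih]
    refine ⟨e 0 + e (2 * a + 1), fun i => ?_⟩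
    by_cases hi : H.y i = 0
    · rw [hi]
      by_contra h
      obtain ⟨j, hj⟩ := (he.leg_iff _).1 h
      refine (he.leg_iff i).2 ⟨2 * a + 1 - j, ?_⟩ hi
      have := hsum j
      linarith
    · obtain ⟨j, rfl⟩ := (he.leg_iff i).1 hi
      rw [← hsum j, add_sub_cancel_left]
      refine y_eq_swapLegs hi (hleg _) ?_
      have := hside j
      rcases Int.units_eq_one_or (H.side (e j)) with h1 | h1 <;>
        rcases Int.units_eq_one_or (H.side (e (2 * a + 1 - j))) with h2 | h2 <;>
        rw [h1, h2] at this ⊢ <;> revert this <;> decide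
  · right
    obtain ⟨hper, M, hM, θ, hw⟩ := ChordSystem.exists_winding hev
    rw [hSm] at hper
    have hζm : ζ ^ m = -1 := hm'.resolve_left hper
    have hζθ : ζ ^ ((m : ℤ) * (θ : ℤ)) = -1 := by
      rcases Int.units_eq_one_or θ with rfl | rfl
      · simp [hζm]
      · simp [zpow_neg, hζm]
    have hζ0 : ζ ≠ 0 := by
      rintro rfl
      simp at hζ
    have hside : ∀ j, H.side (e (j + M)) = -H.side (e j) := by
      intro j
      obtain ⟨h1, h2, h3⟩ := hw j
      -- Half a turn around the vertices reverses the direction of the trajectory.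
      have h4 : H.dirAfter (e (j + M) - 1) = -H.dirAfter (e j - 1) := by
        rw [hlev (j + M), hlev j, h3, hSm, zpow_add₀ hζ0, hζθ]
        ring
      have h5 := H.sign_pos (i := e j - 1) (by rw [sub_add_cancel]; exact hleg j)
      have h6 := H.sign_pos (i := e (j + M) - 1) (by rw [sub_add_cancel]; exact hleg _)
      rw [hdir, hdir] at h1
      rw [sub_add_cancel] at h5 h6
      rw [h4, h1, Complex.neg_re, Complex.neg_im] at h6
      rcases Int.units_eq_one_or (e j).negOnePow with a1 | a1 <;>
        rcases Int.units_eq_one_or (e (j + M)).negOnePow with a2 | a2 <;>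
        rw [a1] at h5 h1 <;> rw [a2] at h6 h1
      · push_cast at h5 h6; rw [a1] at h6; push_cast at h6; linarith
      · rw [neg_one_mul, one_mul] at h1
        rw [← h1, neg_neg]
      · simpa using h1
      · push_cast at h5 h6; rw [a1] at h6; push_cast at h6; linarith
    have hshift : ∀ j, e (j + M) - e j = e (0 + M) - e 0 := by
      have hstep : ∀ j, e (j + 1 + M) - e (j + 1) = e (j + M) - e j := by
        intro j
        have h1 := hgap j
        have h2 := hgap (j + M)
        rw [(hw j).2.1] at h2
        rw [show j + 1 + (M : ℤ) = j + M + 1 by ring]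
        linarith
      intro j
      induction j using Int.induction_on with
      | zero => rfl
      | succ k ih => rw [hstep, ih]
      | pred k ih =>
        have := hstep (-k - 1)
        rw [sub_add_cancel] at this
        rw [← this, ih]
    refine ⟨e (0 + M) - e 0, fun i => ?_⟩
    by_cases hi : H.y i = 0
    · rw [hi]
      by_contra h
      obtain ⟨j, hj⟩ := (he.leg_iff _).1 h
      refine (he.leg_iff i).2 ⟨j - M, ?_⟩ hi
      have := hshift (j - M)
      rw [sub_add_cancel] at this
      linarith
    · obtain ⟨j, rfl⟩ := (he.leg_iff i).1 hi
      rw [← hshift j, add_sub_cancel]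
      exact y_eq_swapLegs hi (hleg _) (hside j)

end HitSequence

/-! ### Trajectories in the normalised triangle -/

/-- A periodic billiard trajectory in the triangle `-1`, `1`, `c i`, of piecewise constant velocity; the
speed is not normalised. -/
structure IsStdTrajectory (c : ℝ) (ζ : ℂ) (F : ℝ → ℂ) (L : ℝ) : Prop where
  pos : 0 < L
  periodic : Function.Periodic F L
  nonneg : ∀ t i, 0 ≤ height c i (F t)
  edge_unique : ∀ t i j, height c i (F t) = 0 → height c j (F t) = 0 → i = j
  straight : ∀ t, (∀ i, height c i (F t) ≠ 0) →
    ∃ u : ℂ, u ≠ 0 ∧ ∀ᶠ s in nhds t, F s = F t + (s - t) • u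
  reflect : ∀ t i, height c i (F t) = 0 →
    ∃ u : ℂ, u ≠ 0 ∧
      (∀ᶠ s in nhdsWithin t (Set.Iic t), F s = F t + (s - t) • u) ∧
      (∀ᶠ s in nhdsWithin t (Set.Ici t), F s = F t + (s - t) • dirRefl ζ i u)

theorem height_add_smul (c : ℝ) (i : Fin 3) (z u : ℂ) (s : ℝ) :
    height c i (z + s • u) = height c i z + s * (height c i (z + u) - height c i z) := by
  fin_cases i <;> simp [height] <;> ring

theorem dirRefl_ne_zero {ζ : ℂ} (hζ : ‖ζ‖ = 1) (i : Fin 3) {u : ℂ} (hu : u ≠ 0) :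
    dirRefl ζ i u ≠ 0 := by
  have hζ0 : ζ ≠ 0 := by
    rintro rfl
    simp at hζ
  fin_cases i <;> simp [dirRefl, hu, hζ0]

/-- An affine germ determines its slope. -/
theorem affine_germ_unique {F : ℝ → ℂ} {t : ℝ} {l : Filter ℝ} [l.NeBot] (hl : ∀ᶠ s in l, s ≠ t)
    {u v : ℂ} (hu : ∀ᶠ s in l, F s = F t + (s - t) • u) (hv : ∀ᶠ s in l, F s = F t + (s - t) • v) :
    u = v := by
  obtain ⟨s, hs, h1, h2⟩ := (hl.and (hu.and hv)).exists
  rw [h1] at h2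
  exact smul_right_injective ℂ (sub_ne_zero.2 hs) (add_left_cancel h2)

namespace IsStdTrajectory

variable {c : ℝ} {ζ : ℂ} {F : ℝ → ℂ} {L : ℝ} (hF : IsStdTrajectory c ζ F L)

include hF

theorem exists_germs (hζ : ‖ζ‖ = 1) (t : ℝ) : ∃ u v : ℂ, u ≠ 0 ∧ v ≠ 0 ∧
    (∀ᶠ s in nhdsWithin t (Set.Iic t), F s = F t + (s - t) • u) ∧
    (∀ᶠ s in nhdsWithin t (Set.Ici t), F s = F t + (s - t) • v) ∧
    ((∀ i, height c i (F t) ≠ 0) → v = u) ∧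
    ∀ i, height c i (F t) = 0 → v = dirRefl ζ i u := by
  by_cases h : ∃ i, height c i (F t) = 0
  · obtain ⟨i, hi⟩ := h
    obtain ⟨u, hu, h1, h2⟩ := hF.reflect t i hi
    refine ⟨u, _, hu, dirRefl_ne_zero hζ i hu, h1, h2, fun h => absurd hi (h i), fun j hj => ?_⟩
    rw [hF.edge_unique t i j hi hj]
  · push Not at h
    obtain ⟨u, hu, h1⟩ := hF.straight t h
    exact ⟨u, u, hu, hu, h1.filter_mono nhdsWithin_le_nhds, h1.filter_mono nhdsWithin_le_nhds,
      fun _ => rfl, fun i hi => absurd hi (h i)⟩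

theorem continuous (hζ : ‖ζ‖ = 1) : Continuous F := by
  rw [continuous_iff_continuousAt]
  intro t
  obtain ⟨u, v, -, -, h1, h2, -⟩ := hF.exists_germs hζ t
  have key : ∀ w : ℂ, ContinuousAt (fun s : ℝ => F t + (s - t) • w) t := fun w => by fun_prop
  rw [continuousAt_iff_continuous_left_right]
  exact ⟨(key u).continuousWithinAt.congr_of_eventuallyEq h1 (by simp),
    (key v).continuousWithinAt.congr_of_eventuallyEq h2 (by simp)⟩

/-- The trajectory is a line segment until it hits an edge. -/
theorem eq_segment (hζ : ‖ζ‖ = 1) {a b : ℝ} (hab : a ≤ b) {v : ℂ}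
    (hv : ∀ᶠ s in nhdsWithin a (Set.Ici a), F s = F a + (s - a) • v)
    (hno : ∀ t ∈ Set.Ioo a b, ∀ i, height c i (F t) ≠ 0) :
    ∀ s ∈ Set.Icc a b, F s = F a + (s - a) • v := by
  have hcont := hF.continuous hζ
  have hclosed : IsClosed {x : ℝ | ∀ s ∈ Set.Icc a x, F s = F a + (s - a) • v} := by
    have hE : IsClosed {s : ℝ | F s = F a + (s - a) • v} := isClosed_eq hcont (by fun_prop)
    rw [← isOpen_compl_iff, isOpen_iff_mem_nhds]
    intro x hx
    simp only [Set.mem_compl_iff, Set.mem_ofPred_eq, not_forall] at hx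
    obtain ⟨s, ⟨hs1, hs2⟩, hs3⟩ := hx
    rcases hs2.lt_or_eq with hs2 | rfl
    · filter_upwards [Ioi_mem_nhds hs2] with y hy h
      exact hs3 (h s ⟨hs1, hy.le⟩)
    · rcases hs1.lt_or_eq with hs1 | rfl
      · have : {s : ℝ | F s = F a + (s - a) • v}ᶜ ∈ nhds s := hE.isOpen_compl.mem_nhds hs3
        obtain ⟨l, hl, hl'⟩ := exists_Ioc_subset_of_mem_nhds this ⟨a, hs1⟩
        have hm : max l a < s := max_lt hl hs1
        obtain ⟨r, hr1, hr2⟩ := exists_between hm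
        filter_upwards [Ioi_mem_nhds hr2] with y hy h
        exact hl' ⟨(le_max_left _ _).trans_lt hr1, hr2.le⟩
          (h r ⟨((le_max_right _ _).trans_lt hr1).le, hy.le⟩)
      · simp at hs3
  have hsub : Set.Icc a b ⊆ {x : ℝ | ∀ s ∈ Set.Icc a x, F s = F a + (s - a) • v} := by
    refine (hclosed.inter isClosed_Icc).Icc_subset_of_forall_exists_gt ?_ ?_
    · intro s hs
      obtain rfl : s = a := le_antisymm hs.2 hs.1
      simp
    · rintro x ⟨hx, hxa, hxb⟩ y hy
      -- The slope of the right germ at `x` is still `v`.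
      have hright : ∀ᶠ s in nhdsWithin x (Set.Ici x), F s = F a + (s - a) • v := by
        rcases hxa.lt_or_eq with hxa | rfl
        · obtain ⟨u, w, -, -, h1, h2, h3, -⟩ := hF.exists_germs hζ x
          obtain rfl := h3 (hno x ⟨hxa, hxb⟩)
          have hxx := hx x ⟨hxa.le, le_rfl⟩
          have hl : ∀ᶠ s in nhdsWithin x (Set.Iio x), F s = F x + (s - x) • v := by
            filter_upwards [Ioo_mem_nhdsLT hxa] with s hs
            rw [hx s ⟨hs.1.le, hs.2.le⟩, hxx, add_assoc, ← add_smul]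
            congr 2
            ring
          obtain rfl := affine_germ_unique (l := nhdsWithin x (Set.Iio x))
            (Filter.eventually_of_mem self_mem_nhdsWithin fun s hs => ne_of_lt hs)
            (h1.filter_mono (nhdsWithin_mono _ Set.Iio_subset_Iic_self)) hl
          filter_upwards [h2] with s hs
          rw [hs, hxx, add_assoc, ← add_smul]
          congr 2
          ring
        · exact hv
      obtain ⟨r, hr, hr'⟩ := (mem_nhdsGE_iff_exists_Ico_subset).1 hright
      have hm : x < min r y := lt_min hr hy
      obtain ⟨z, hz1, hz2⟩ := exists_between hm
      refine ⟨z, fun s hs => ?_, hz1, hz2.le.trans (min_le_right _ _)⟩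
      rcases le_or_gt s x with h | h
      · exact hx s ⟨hs.1, h⟩
      · exact hr' ⟨h.le, hs.2.trans_lt (hz2.trans_le (min_le_left _ _))⟩
  exact hsub ⟨hab, le_rfl⟩

theorem exists_hit (hζ : ‖ζ‖ = 1) : ∃ t ∈ Set.Ico 0 L, ∃ i, height c i (F t) = 0 := by
  by_contra! h
  obtain ⟨u, v, -, hv, -, h2, -⟩ := hF.exists_germs hζ 0
  have := hF.eq_segment hζ hF.pos.le h2 (fun t ht => h t ⟨ht.1.le, ht.2⟩) L ⟨hF.pos.le, le_rfl⟩
  have h0 : F L = F 0 := by simpa using hF.periodic 0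
  rw [h0] at this
  simp [hv, hF.pos.ne'] at this

/-- The hits of a trajectory that avoids the midpoint of the base form a hit sequence. -/
theorem exists_hitSequence (hζ : ‖ζ‖ = 1) (hM : ∀ t, F t ≠ 0) {n : ℕ} (hn : 0 < n) {T : ℤ → ℝ}
    (hT : StrictMono T) (hTr : Set.range T = {t | ∃ i, height c i (F t) = 0})
    (hTn : ∀ i, T (i + n) = T i + L) {y : ℤ → Fin 3} (hy : ∀ j, height c (y j) (F (T j)) = 0) :
    ∃ H : HitSequence c ζ, H.n = n ∧ H.y = y := by
  have hno : ∀ i, ∀ t ∈ Set.Ioo (T i) (T (i + 1)), ∀ k, height c k (F t) ≠ 0 := by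
    intro i t ht k hk
    have : t ∈ Set.range T := by rw [hTr]; exact ⟨k, hk⟩
    obtain ⟨j, rfl⟩ := this
    have h1 := hT.lt_iff_lt.1 ht.1
    have h2 := hT.lt_iff_lt.1 ht.2
    omega
  choose u v hu hv hleft hright _ hrefl using fun i => hF.exists_germs hζ (T i)
  have hlt : ∀ i, T i < T (i + 1) := fun i => hT (by omega)
  have hseg := fun i => hF.eq_segment hζ (hlt i).le (hright i) (hno i)
  have hsucc : ∀ i, F (T (i + 1)) = F (T i) + (T (i + 1) - T i) • v i :=
    fun i => hseg i _ ⟨(hlt i).le, le_rfl⟩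
  have hyn : ∀ i, y (i + n) = y i := by
    intro i
    apply hF.edge_unique (T i) _ _ _ (hy i)
    rw [← hF.periodic (T i), ← hTn]
    exact hy _
  have hpn : ∀ i, F (T (i + n)) = F (T i) := by
    intro i
    rw [hTn, hF.periodic]
  refine ⟨{
    n := n
    n_pos := hn
    y := y
    p := fun i => F (T i)
    v := v
    τ := fun i => T (i + 1) - T i
    τ_pos := fun i => sub_pos.2 (hlt i)
    v_ne_zero := hv
    p_succ := hsucc
    v_succ := ?_
    on_edge := hy
    off_edge := fun i j hj => lt_of_le_of_ne (hF.nonneg _ _)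
      fun h => hj (hF.edge_unique _ _ _ h.symm (hy i))
    y_succ_ne := ?_
    p_ne_zero := fun i => hM _
    y_add := hyn
    p_add := hpn
    v_add := ?_ }, rfl, rfl⟩
  · intro i
    rw [hrefl (i + 1) _ (hy _)]
    congr 1
    refine affine_germ_unique (l := nhdsWithin (T (i + 1)) (Set.Iio (T (i + 1))))
      (Filter.eventually_of_mem self_mem_nhdsWithin fun s hs => ne_of_lt hs)
      ((hleft _).filter_mono (nhdsWithin_mono _ Set.Iio_subset_Iic_self)) ?_
    filter_upwards [Ioo_mem_nhdsLT (hlt i)] with s hs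
    rw [hseg i s ⟨hs.1.le, hs.2.le⟩, hsucc, add_assoc, ← add_smul]
    congr 2
    ring
  · intro i h
    obtain ⟨s, hs1, hs2⟩ := exists_between (hlt i)
    refine hno i s ⟨hs1, hs2⟩ (y i) ?_
    have h1 := hy (i + 1)
    rw [h, hsucc, height_add_smul, hy i, zero_add] at h1
    rw [hseg i s ⟨hs1.le, hs2.le⟩, height_add_smul, hy i,
      (mul_eq_zero.1 h1).resolve_left (sub_pos.2 (hlt i)).ne', mul_zero, add_zero]
  · intro i
    have h1 := hsucc (i + n)
    rw [show i + (n : ℤ) + 1 = i + 1 + n by ring, hpn, hpn, hTn, hTn, hsucc] at h1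
    have h2 := add_left_cancel h1
    rw [show T (i + 1) + L - (T i + L) = T (i + 1) - T i by ring] at h2
    exact (smul_right_injective ℂ (sub_pos.2 (hlt i)).ne' h2).symm

end IsStdTrajectory

/-! ### Normalisation by a similarity -/

/-- `exp (2 i β)` for the base angle `β = arctan c`. -/
noncomputable def apexRotation (c : ℝ) : ℂ := ⟨(1 - c ^ 2) / (1 + c ^ 2), 2 * c / (1 + c ^ 2)⟩

theorem norm_apexRotation (c : ℝ) : ‖apexRotation c‖ = 1 := by
  have h : (1 : ℝ) + c ^ 2 ≠ 0 := by positivity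
  rw [← pow_eq_one_iff_of_nonneg (norm_nonneg _) two_ne_zero, Complex.sq_norm, Complex.normSq_apply,
    apexRotation]
  field_simp
  ring

/-- Under the angle condition, `-1` is a power of `ζ = exp (2 i β)`, unless `ζ` has infinite order. -/
theorem AngleCondition.exists_order {β : ℝ} (h : AngleCondition β) : ∃ m : ℕ,
    (∀ k : ℤ, Complex.exp (2 * β * Complex.I) ^ k = 1 → (m : ℤ) ∣ k) ∧
      (m = 0 ∨ Complex.exp (2 * β * Complex.I) ^ m = -1) := by
  set z : ℂˣ := Units.mk0 (Complex.exp (2 * β * Complex.I)) (Complex.exp_ne_zero _) with hz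
  have hzv : ((z : ℂˣ) : ℂ) = Complex.exp (2 * β * Complex.I) := rfl
  refine ⟨orderOf (z ^ 2), fun k hk => ?_, ?_⟩
  · rw [orderOf_dvd_iff_zpow_eq_one]
    have : z ^ k = 1 := by
      apply Units.ext
      rw [Units.val_zpow_eq_zpow_val, hzv, hk, Units.val_one]
    rw [← zpow_natCast, zpow_comm, this, one_zpow]
  · by_contra! hcon
    obtain ⟨hm, hne⟩ := hcon
    set m := orderOf (z ^ 2) with hmdef
    have h1 : Complex.exp (2 * β * Complex.I) ^ m = 1 := by
      have h2 : (z ^ 2) ^ m = 1 := pow_orderOf_eq_one _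
      have h3 : (Complex.exp (2 * β * Complex.I) ^ m) ^ 2 = 1 := by
        rw [← hzv, ← Units.val_pow_eq_pow_val, ← Units.val_pow_eq_pow_val, ← pow_mul, mul_comm,
          pow_mul, h2, Units.val_one]
      exact (mul_self_eq_one_iff.1 ((sq _).symm.trans h3)).resolve_right hne
    rcases h with h | ⟨q, hq, d, hd⟩
    · have h2 := h1
      rw [← Complex.exp_nat_mul, Complex.exp_eq_one_iff] at h2
      obtain ⟨k, hk⟩ := h2
      have h3 : (m : ℝ) * β = k * Real.pi := by
        have h4 : ((m * β : ℝ) : ℂ) = ((k * Real.pi : ℝ) : ℂ) := by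
          push_cast
          apply mul_right_cancel₀ (mul_ne_zero two_ne_zero Complex.I_ne_zero)
          linear_combination hk
        exact_mod_cast h4
      apply h
      refine ⟨(k : ℚ) / m, ?_⟩
      have hm' : (m : ℝ) ≠ 0 := by exact_mod_cast hm
      have := Real.pi_ne_zero
      push_cast
      field_simp
      linarith
    · have hodd : Odd q.num := by
        rw [← Int.not_even_iff_odd]
        intro h2
        have h3 := q.reduced
        have h4 : 2 ∣ q.num.natAbs := by
          obtain ⟨r, hr⟩ := h2
          omega
        have h5 : 2 ∣ q.den := ⟨d, by omega⟩
        have := Nat.dvd_gcd h4 h5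
        rw [h3] at this
        omega
      have hqd : (q : ℂ) * (2 * d) = q.num := by
        have h2 : (q : ℚ) * q.den = q.num := Rat.mul_den_eq_num q
        rw [hd] at h2
        have h3 : ((q * (d + d : ℕ) : ℚ) : ℂ) = ((q.num : ℚ) : ℂ) := by rw [h2]
        push_cast at h3
        linear_combination h3
      have hzd : Complex.exp (2 * β * Complex.I) ^ d = -1 := by
        rw [← Complex.exp_nat_mul, hq]
        push_cast
        rw [show (d : ℂ) * (2 * (q * Real.pi) * Complex.I) = q.num * (Real.pi * Complex.I) by
          rw [← hqd]; ring, Complex.exp_int_mul, Complex.exp_pi_mul_I, hodd.neg_one_zpow]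
      have hdvd : m ∣ d := by
        rw [hmdef, orderOf_dvd_iff_pow_eq_one]
        apply Units.ext
        rw [← pow_mul, mul_comm, pow_mul, Units.val_pow_eq_pow_val, Units.val_pow_eq_pow_val, hzv,
          hzd]
        simp
      obtain ⟨r, rfl⟩ := hdvd
      rw [pow_mul, h1, one_pow] at hzd
      norm_num at hzd

open Complex in
/-- An isosceles triangle is similar to the triangle `-1`, `1`, `c i` for some `c > 0`. -/
theorem exists_similarity {A B C : ℂ} (hT : AffineIndependent ℝ ![A, B, C])
    (hiso : dist C A = dist C B) : ∃ (Λ : ℂ →ₗ[ℝ] ℂ) (c k : ℝ), 0 < c ∧ 0 < k ∧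
      Λ (B - midpoint ℝ A B) = 1 ∧ Λ (C - midpoint ℝ A B) = c * I ∧
      ∀ u w, inner ℝ (Λ u) (Λ w) = k * inner ℝ u w := by
  set b := B - midpoint ℝ A B with hb
  have hA : A - midpoint ℝ A B = -b := by
    rw [hb, midpoint_eq_smul_add]
    simp
    ring
  have hb0 : b ≠ 0 := by
    intro h
    have h1 : A = B := by
      rw [h, neg_zero] at hA
      rw [sub_eq_zero.1 hA, ← sub_eq_zero.1 h]
    exact absurd (hT.injective (a₁ := 0) (a₂ := 1) h1) (by decide)
  set κ := (C - midpoint ℝ A B) / b with hκ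
  have hκb : C - midpoint ℝ A B = κ * b := by rw [hκ, div_mul_cancel₀ _ hb0]
  have hre : κ.re = 0 := by
    have h1 : C - A = (κ + 1) * b := by
      rw [add_mul, one_mul, ← hκb, ← neg_neg b, ← hA]; ring
    have h2 : C - B = (κ - 1) * b := by
      rw [sub_mul, one_mul, ← hκb, hb]; ring
    rw [dist_eq_norm, dist_eq_norm, h1, h2, norm_mul, norm_mul] at hiso
    have h3 := mul_right_cancel₀ (norm_ne_zero_iff.2 hb0) hiso
    have h4 : normSq (κ + 1) = normSq (κ - 1) := by
      rw [← Complex.sq_norm, ← Complex.sq_norm, h3]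
    simp [normSq_apply] at h4
    linarith
  have him : κ.im ≠ 0 := by
    intro h
    have h1 : κ = 0 := Complex.ext hre h
    rw [h1, zero_mul, sub_eq_zero] at hκb
    rw [affineIndependent_iff_not_collinear_set] at hT
    apply hT
    have h2 : C ∈ line[ℝ, A, B] := by
      rw [hκb]
      exact AffineMap.lineMap_mem_affineSpan_pair _ _ _
    have h3 := collinear_insert_of_mem_affineSpan_pair h2
    rwa [show ({A, B, C} : Set ℂ) = {C, A, B} by ext; simp; tauto]
  have hk : 0 < (normSq b)⁻¹ := inv_pos.2 (normSq_pos.2 hb0)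
  have hinner : ∀ u w : ℂ, inner ℝ (b⁻¹ * u) (b⁻¹ * w) = (normSq b)⁻¹ * inner ℝ u w := by
    intro u w
    simp only [Complex.inner, map_mul]
    rw [show b⁻¹ * w * ((starRingEnd ℂ) b⁻¹ * (starRingEnd ℂ) u) =
      (b⁻¹ * (starRingEnd ℂ) b⁻¹) * (w * (starRingEnd ℂ) u) by ring, mul_conj, re_ofReal_mul,
      normSq_inv]
  rcases lt_or_gt_of_ne him with h | h
  · refine ⟨conjAe.toLinearMap ∘ₗ LinearMap.mulLeft ℝ b⁻¹, -κ.im, _, by linarith, hk, ?_, ?_, ?_⟩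
    · simp [hb0]
    · rw [hκb]
      simp only [LinearMap.comp_apply, LinearMap.mulLeft_apply, AlgEquiv.toLinearMap_apply,
        conjAe_coe]
      rw [mul_comm κ, inv_mul_cancel_left₀ hb0]
      apply Complex.ext <;> simp [hre]
    · intro u w
      rw [← hinner]
      simp [Complex.inner]
      ring
  · refine ⟨LinearMap.mulLeft ℝ b⁻¹, κ.im, _, h, hk, ?_, ?_, ?_⟩
    · simp [hb0]
    · rw [hκb, LinearMap.mulLeft_apply, mul_comm κ, inv_mul_cancel_left₀ hb0]
      apply Complex.ext <;> simp [hre]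
    · exact hinner

/-- A similarity that carries the triangle `A B C` to the triangle `-1`, `1`, `c i`, by its linear
part. -/
structure IsNormalisation (A B C : ℂ) (Λ : ℂ →ₗ[ℝ] ℂ) (c k : ℝ) : Prop where
  c_pos : 0 < c
  k_pos : 0 < k
  map_B : Λ (B - midpoint ℝ A B) = 1
  map_C : Λ (C - midpoint ℝ A B) = c * Complex.I
  inner_map : ∀ u w, inner ℝ (Λ u) (Λ w) = k * inner ℝ u w

/-- The normalising map of the plane. -/
noncomputable def normMap (A B : ℂ) (Λ : ℂ →ₗ[ℝ] ℂ) : ℂ →ᵃ[ℝ] ℂ :=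
  Λ.toAffineMap.comp (AffineMap.id ℝ ℂ - AffineMap.const ℝ ℂ (midpoint ℝ A B))

theorem normMap_apply (A B : ℂ) (Λ : ℂ →ₗ[ℝ] ℂ) (z : ℂ) :
    normMap A B Λ z = Λ (z - midpoint ℝ A B) := rfl

theorem normMap_midpoint (A B : ℂ) (Λ : ℂ →ₗ[ℝ] ℂ) : normMap A B Λ (midpoint ℝ A B) = 0 := by
  rw [normMap_apply, sub_self, map_zero]

theorem segment_neg_one_one {w : ℂ} :
    w ∈ segment ℝ (-1 : ℂ) 1 ↔ w.im = 0 ∧ -1 ≤ w.re ∧ w.re ≤ 1 := by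
  rw [segment_eq_image']
  constructor
  · rintro ⟨t, ⟨h0, h1⟩, rfl⟩
    simp
    constructor <;> linarith
  · rintro ⟨h1, h2, h3⟩
    refine ⟨(w.re + 1) / 2, ⟨by linarith, by linarith⟩, ?_⟩
    apply Complex.ext <;> simp [h1]

theorem segment_to_apex {c : ℝ} (hc : 0 < c) (s : ℝ) {w : ℂ} :
    w ∈ segment ℝ (s : ℂ) (c * Complex.I) ↔ w.re = s * (1 - w.im / c) ∧ 0 ≤ w.im ∧ w.im ≤ c := by
  rw [segment_eq_image']
  constructor
  · rintro ⟨t, ⟨h0, h1⟩, rfl⟩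
    simp
    field_simp
    refine ⟨by ring, by positivity, by linarith⟩
  · rintro ⟨h1, h2, h3⟩
    refine ⟨w.im / c, ⟨by positivity, by rwa [div_le_one hc]⟩, ?_⟩
    apply Complex.ext <;> simp [h1] <;> field_simp; ring

namespace IsNormalisation

variable {A B C : ℂ} {Λ : ℂ →ₗ[ℝ] ℂ} {c k : ℝ} (hN : IsNormalisation A B C Λ c k)

include hN

theorem norm_sq (u : ℂ) : ‖Λ u‖ ^ 2 = k * ‖u‖ ^ 2 := by
  rw [← real_inner_self_eq_norm_sq, ← real_inner_self_eq_norm_sq, hN.inner_map]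

theorem injective : Function.Injective Λ := by
  rw [← LinearMap.ker_eq_bot, LinearMap.ker_eq_bot']
  intro u hu
  have h := hN.norm_sq u
  rw [hu, norm_zero] at h
  have h1 := (mul_eq_zero.1 (h.symm.trans (by norm_num))).resolve_left hN.k_pos.ne'
  exact norm_eq_zero.1 (pow_eq_zero_iff two_ne_zero |>.1 h1)

theorem map_A : Λ (A - midpoint ℝ A B) = -1 := by
  rw [← hN.map_B, ← map_neg]
  congr 1
  rw [midpoint_eq_smul_add]
  simp
  ring

theorem normMap_injective : Function.Injective (normMap A B Λ) := by
  intro z w h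
  rw [normMap_apply, normMap_apply] at h
  exact sub_left_injective (hN.injective h)

theorem normMap_A : normMap A B Λ A = -1 := hN.map_A

theorem normMap_B : normMap A B Λ B = 1 := hN.map_B

theorem normMap_C : normMap A B Λ C = c * Complex.I := hN.map_C

theorem mem_segment_iff (z p q : ℂ) :
    z ∈ segment ℝ p q ↔ normMap A B Λ z ∈ segment ℝ (normMap A B Λ p) (normMap A B Λ q) := by
  rw [← image_segment, hN.normMap_injective.mem_set_image]

theorem height_nonneg {z : ℂ} (hz : z ∈ convexHull ℝ (Set.range (triangleT A B C))) (i : Fin 3) :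
    0 ≤ height c i (normMap A B Λ z) := by
  have hconv : Convex ℝ {z | 0 ≤ height c i (normMap A B Λ z)} := by
    intro x hx y hy a b ha hb hab
    simp only [Set.mem_ofPred_eq] at hx hy ⊢
    rw [Convex.combo_affine_apply hab]
    have : height c i (a • normMap A B Λ x + b • normMap A B Λ y) =
        a * height c i (normMap A B Λ x) + b * height c i (normMap A B Λ y) := by
      obtain rfl : b = 1 - a := by linarith
      fin_cases i <;> simp [height] <;> ring
    rw [this]
    positivity
  refine convexHull_min ?_ hconv hz
  rintro _ ⟨j, rfl⟩
  have hc := hN.c_pos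
  simp only [Set.mem_ofPred_eq]
  fin_cases j
  · simp only [triangleT, Fin.zero_eta, Matrix.cons_val_zero]
    rw [hN.normMap_A]
    fin_cases i <;> simp [height]
    positivity
  · simp only [triangleT, Fin.mk_one, Matrix.cons_val_one, Matrix.cons_val_zero]
    rw [hN.normMap_B]
    fin_cases i <;> simp [height]
    positivity
  · simp only [triangleT, Fin.reduceFinMk, Matrix.cons_val]
    rw [hN.normMap_C]
    fin_cases i <;> simp [height]
    positivity

theorem mem_edge_iff {z : ℂ} (hz : z ∈ convexHull ℝ (Set.range (triangleT A B C))) (i : Fin 3) :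
    z ∈ edge (triangleT A B C) i ↔ height c i (normMap A B Λ z) = 0 := by
  have hc := hN.c_pos
  have h0 := hN.height_nonneg hz 0
  have h1 := hN.height_nonneg hz 1
  have h2 := hN.height_nonneg hz 2
  rw [edge, hN.mem_segment_iff]
  generalize normMap A B Λ z = w at *
  simp [height] at h0 h1 h2
  fin_cases i
  · simp only [triangleT, Fin.zero_eta, zero_add, Matrix.cons_val_zero, Matrix.cons_val_one]
    rw [hN.normMap_A, hN.normMap_B, segment_neg_one_one]
    simp only [height, Matrix.cons_val_zero]
    refine ⟨fun h => h.1, fun h => ⟨h, ?_, ?_⟩⟩ <;> nlinarith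
  · simp only [triangleT, Fin.mk_one, Fin.reduceAdd, Matrix.cons_val_one, Matrix.cons_val,
      Matrix.cons_val_zero]
    rw [hN.normMap_B, hN.normMap_C, ← Complex.ofReal_one, segment_to_apex hc]
    simp [height]
    refine ⟨fun h => ?_, fun h => ⟨?_, h0, by linarith⟩⟩
    · rw [h.1]; field_simp; ring
    · field_simp; linarith
  · simp only [triangleT, Fin.reduceFinMk, Fin.reduceAdd, Matrix.cons_val, Matrix.cons_val_zero]
    rw [hN.normMap_C, hN.normMap_A, segment_symm, ← Complex.ofReal_one, ← Complex.ofReal_neg,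
      segment_to_apex hc]
    simp [height]
    refine ⟨fun h => ?_, fun h => ⟨?_, h0, by linarith⟩⟩
    · rw [h.1]; field_simp; ring
    · field_simp; linarith

/-- In normalised coordinates the folding takes the absolute value of the abscissa. -/
theorem normMap_fold (z : ℂ) : normMap A B Λ (fold A B z) =
    ⟨|(normMap A B Λ z).re|, (normMap A B Λ z).im⟩ := by
  have hdist : dist z A < dist z B ↔ (normMap A B Λ z).re < 0 := by
    have h1 : ∀ p, k * dist z p ^ 2 = ‖normMap A B Λ z - normMap A B Λ p‖ ^ 2 := by
      intro p
      rw [normMap_apply, normMap_apply, ← map_sub, hN.norm_sq, dist_eq_norm, sub_sub_sub_cancel_right]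
    rw [← pow_lt_pow_iff_left₀ dist_nonneg dist_nonneg two_ne_zero,
      ← mul_lt_mul_iff_right₀ hN.k_pos, h1, h1, hN.normMap_A, hN.normMap_B, Complex.sq_norm,
      Complex.sq_norm, Complex.normSq_apply, Complex.normSq_apply]
    simp
    constructor <;> intro h <;> nlinarith
  rw [fold]
  split_ifs with h
  · rw [hdist] at h
    set x := (normMap A B Λ z).re with hx
    set b := B - midpoint ℝ A B with hb
    have hzdec : z = (x • b : ℂ) +ᵥ (z - x • b) := by simp
    have hmem : z - x • b ∈ AffineSubspace.perpBisector A B := by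
      have h1 : ∀ p, k * dist (z - x • b) p ^ 2 =
          ‖normMap A B Λ z - x - normMap A B Λ p‖ ^ 2 := by
        intro p
        have : normMap A B Λ z - x - normMap A B Λ p = Λ (z - x • b - p) := by
          have h2 : (x : ℂ) = Λ (x • b) := by rw [map_smul, hN.map_B]; simp
          rw [h2, normMap_apply, normMap_apply, ← map_sub, ← map_sub]
          congr 1
          ring
        rw [this, hN.norm_sq, dist_eq_norm]
      rw [AffineSubspace.mem_perpBisector_iff_dist_eq,
        ← pow_left_inj₀ dist_nonneg dist_nonneg two_ne_zero]
      apply mul_left_cancel₀ hN.k_pos.ne'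
      rw [h1, h1, hN.normMap_A, hN.normMap_B, Complex.sq_norm, Complex.sq_norm,
        Complex.normSq_apply, Complex.normSq_apply]
      simp [hx]
    have horth : (x • b : ℂ) ∈ (AffineSubspace.perpBisector A B).directionᗮ := by
      rw [AffineSubspace.direction_perpBisector]
      apply Submodule.le_orthogonal_orthogonal
      rw [Submodule.mem_span_singleton]
      refine ⟨x / 2, ?_⟩
      rw [hb, vsub_eq_sub, midpoint_eq_smul_add]
      simp
      ring
    have hrefl : EuclideanGeometry.reflection (AffineSubspace.perpBisector A B) z =
        -(x • b) +ᵥ (z - x • b) := by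
      conv_lhs => rw [hzdec]
      exact EuclideanGeometry.reflection_orthogonal_vadd hmem horth
    have : (-(x • b) +ᵥ (z - x • b)) - midpoint ℝ A B = (z - midpoint ℝ A B) - (2 * x) • b := by
      rw [vadd_eq_add, two_mul, add_smul]
      ring
    rw [hrefl, normMap_apply, this, map_sub, map_smul, hN.map_B, abs_of_neg h]
    rw [← normMap_apply]
    apply Complex.ext
    · simp [← hx]
      ring
    · simp
  · rw [hdist, not_lt] at h
    rw [abs_of_nonneg h]

theorem mem_edge_fold_zero {z : ℂ} (hz : z ∈ convexHull ℝ (Set.range (triangleT A B C))) :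
    fold A B z ∈ edge (triangleT' A B C) 0 ↔ (normMap A B Λ z).im = 0 := by
  have hc := hN.c_pos
  have h0 := hN.height_nonneg hz 0
  have h1 := hN.height_nonneg hz 1
  have h2 := hN.height_nonneg hz 2
  rw [edge, hN.mem_segment_iff, hN.normMap_fold]
  generalize normMap A B Λ z = w at *
  simp [height] at h0 h1 h2
  simp only [triangleT', zero_add, Matrix.cons_val_zero, Matrix.cons_val_one]
  rw [normMap_midpoint, hN.normMap_B, segment_eq_image']
  constructor
  · rintro ⟨t, -, h⟩
    have := congrArg Complex.im h
    simpa using this.symm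
  · intro h
    refine ⟨|w.re|, ⟨abs_nonneg _, ?_⟩, ?_⟩
    · rw [abs_le]; constructor <;> nlinarith
    · apply Complex.ext <;> simp [h]

theorem mem_edge_fold_one {z : ℂ} (hz : z ∈ convexHull ℝ (Set.range (triangleT A B C))) :
    fold A B z ∈ edge (triangleT' A B C) 1 ↔
      height c 1 (normMap A B Λ z) = 0 ∨ height c 2 (normMap A B Λ z) = 0 := by
  have hc := hN.c_pos
  have h0 := hN.height_nonneg hz 0
  have h1 := hN.height_nonneg hz 1
  have h2 := hN.height_nonneg hz 2
  rw [edge, hN.mem_segment_iff, hN.normMap_fold]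
  generalize normMap A B Λ z = w at *
  simp [height] at h0 h1 h2
  simp only [triangleT', Fin.reduceAdd, Matrix.cons_val_one, Matrix.cons_val, Matrix.cons_val_zero]
  rw [hN.normMap_B, hN.normMap_C, ← Complex.ofReal_one, segment_to_apex hc]
  simp [height]
  have : |w.re| = 1 - w.im / c ↔ c * |w.re| = c - w.im := by
    field_simp
  rw [this]
  rcases abs_cases w.re with ⟨h, h'⟩ | ⟨h, h'⟩ <;> rw [h]
  · refine ⟨fun h3 => Or.inl (by linarith), fun h3 => ⟨?_, h0, by nlinarith⟩⟩
    rcases h3 with h3 | h3 <;> nlinarith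
  · refine ⟨fun h3 => Or.inr (by linarith), fun h3 => ⟨?_, h0, by nlinarith⟩⟩
    rcases h3 with h3 | h3 <;> nlinarith

theorem mem_edge_fold_two {z : ℂ} (hz : z ∈ convexHull ℝ (Set.range (triangleT A B C))) :
    fold A B z ∈ edge (triangleT' A B C) 2 ↔ (normMap A B Λ z).re = 0 := by
  have hc := hN.c_pos
  have h0 := hN.height_nonneg hz 0
  have h1 := hN.height_nonneg hz 1
  have h2 := hN.height_nonneg hz 2
  rw [edge, hN.mem_segment_iff, hN.normMap_fold]
  generalize normMap A B Λ z = w at *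
  simp [height] at h0 h1 h2
  simp only [triangleT', Fin.reduceAdd, Matrix.cons_val, Matrix.cons_val_zero]
  rw [normMap_midpoint, hN.normMap_C, segment_symm, ← Complex.ofReal_zero, segment_to_apex hc]
  simp
  exact fun _ => ⟨h0, by linarith⟩

/-- The similarity carries the reflections in the edges to the reflections in the edges. -/
theorem map_edgeReflection (i : Fin 3) (u : ℂ) :
    Λ (edgeReflection (triangleT A B C) i u) = dirRefl (apexRotation c) i (Λ u) := by
  have hc := hN.c_pos
  have h1 : ∀ d u : ℂ, Λ (Submodule.reflection (Submodule.span ℝ {d}) u) =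
      (2 * (inner ℝ (Λ d) (Λ u) / ‖Λ d‖ ^ 2)) • Λ d - Λ u := by
    intro d u
    rw [Submodule.reflection_singleton_apply, map_sub, map_nsmul, map_smul, hN.inner_map, hN.norm_sq,
      mul_div_mul_left _ _ hN.k_pos.ne', mul_smul]
    simp [two_smul]
  rw [edgeReflection, h1]
  have key : ∀ d w : ℂ, (2 * (inner ℝ d w / ‖d‖ ^ 2)) • d - w =
      ⟨2 * ((d.re * w.re + d.im * w.im) / (d.re * d.re + d.im * d.im)) * d.re - w.re,
        2 * ((d.re * w.re + d.im * w.im) / (d.re * d.re + d.im * d.im)) * d.im - w.im⟩ := by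
    intro d w
    have : inner ℝ d w = d.re * w.re + d.im * w.im := by simp [Complex.inner]; ring
    rw [this, Complex.sq_norm, Complex.normSq_apply]
    apply Complex.ext
    · rw [Complex.sub_re, Complex.smul_re, smul_eq_mul]
    · rw [Complex.sub_im, Complex.smul_im, smul_eq_mul]
  have hc2 : (1 : ℝ) + c ^ 2 ≠ 0 := by positivity
  generalize Λ u = w
  have hsub : ∀ p q : ℂ, Λ (p - q) = normMap A B Λ p - normMap A B Λ q := by
    intro p q
    rw [normMap_apply, normMap_apply, ← map_sub, sub_sub_sub_cancel_right]
  rw [hsub, key]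
  fin_cases i
  · simp only [triangleT, Fin.zero_eta, zero_add, Matrix.cons_val_zero, Matrix.cons_val_one]
    rw [hN.normMap_A, hN.normMap_B]
    apply Complex.ext <;> simp [dirRefl]
    ring
  · simp only [triangleT, Fin.mk_one, Fin.reduceAdd, Matrix.cons_val_one, Matrix.cons_val,
      Matrix.cons_val_zero]
    rw [hN.normMap_B, hN.normMap_C]
    have hc3 : (1 : ℝ) + c * c ≠ 0 := by positivity
    apply Complex.ext <;> simp [dirRefl, apexRotation] <;> field_simp <;> ring
  · simp only [triangleT, Fin.reduceFinMk, Fin.reduceAdd, Matrix.cons_val, Matrix.cons_val_zero]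
    rw [hN.normMap_A, hN.normMap_C]
    have hc3 : (1 : ℝ) + c * c ≠ 0 := by positivity
    apply Complex.ext <;> simp [dirRefl, apexRotation] <;> field_simp <;> ring

theorem isStdTrajectory {f : ℝ → ℂ} {L : ℝ} (hf : IsPeriodicTrajectory (triangleT A B C) f L) :
    IsStdTrajectory c (apexRotation c) (normMap A B Λ ∘ f) L := by
  have hc := hN.c_pos
  have hne : ∀ u : ℂ, ‖u‖ = 1 → Λ u ≠ 0 := by
    intro u hu h
    rw [hN.injective (h.trans (map_zero Λ).symm)] at hu
    simp at hu
  have hmap : ∀ (z u : ℂ) (s : ℝ), normMap A B Λ (z + s • u) = normMap A B Λ z + s • Λ u := by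
    intro z u s
    rw [normMap_apply, normMap_apply, ← map_smul, ← map_add]
    congr 1
    ring
  refine ⟨hf.pos, fun t => congrArg (normMap A B Λ) (hf.periodic t),
    fun t i => hN.height_nonneg (hf.mem t) i,
    ?_, ?_, ?_⟩
  · have key : ∀ t i j, i < j → height c i (normMap A B Λ (f t)) = 0 →
        height c j (normMap A B Λ (f t)) ≠ 0 := by
      intro t i j hij hi hj
      have hv : ∀ l, normMap A B Λ (f t) ≠ normMap A B Λ (triangleT A B C l) :=
        fun l h => hf.ne_vertex t l (hN.normMap_injective h)
      have hA := hv 0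
      have hB := hv 1
      have hC := hv 2
      simp only [triangleT, Matrix.cons_val_zero, Matrix.cons_val_one, Matrix.cons_val] at hA hB hC
      rw [hN.normMap_A] at hA
      rw [hN.normMap_B] at hB
      rw [hN.normMap_C] at hC
      generalize normMap A B Λ (f t) = w at *
      fin_cases i <;> fin_cases j <;> simp at hij <;> simp [height] at hi hj
      · apply hB
        apply Complex.ext
        · rw [hi] at hj
          have : c * (1 - w.re) = 0 := by linarith
          have := (mul_eq_zero.1 this).resolve_left hc.ne'
          simp; linarith
        · simpa using hi
      · apply hA
        apply Complex.ext
        · rw [hi] at hj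
          have : c * (1 + w.re) = 0 := by linarith
          have := (mul_eq_zero.1 this).resolve_left hc.ne'
          simp; linarith
        · simpa using hi
      · apply hC
        apply Complex.ext
        · have : c * w.re = 0 := by linarith
          simpa [hc.ne'] using this
        · simp; linarith
    intro t i j hi hj
    rcases lt_trichotomy i j with h | h | h
    · exact absurd hj (key t i j h hi)
    · exact h
    · exact absurd hi (key t j i h hj)
  · intro t ht
    obtain ⟨u, hu, h⟩ := hf.straight t fun i hi => ht i ((hN.mem_edge_iff (hf.mem t) i).1 hi)
    refine ⟨Λ u, hne u hu, ?_⟩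
    filter_upwards [h] with s hs
    rw [Function.comp_apply, hs, hmap]
    rfl
  · intro t i hi
    obtain ⟨u, hu, h1, h2⟩ := hf.reflect t i ((hN.mem_edge_iff (hf.mem t) i).2 hi)
    refine ⟨Λ u, hne u hu, ?_, ?_⟩
    · filter_upwards [h1] with s hs
      rw [Function.comp_apply, hs, hmap]
      rfl
    · filter_upwards [h2] with s hs
      rw [Function.comp_apply, hs, hmap, hN.map_edgeReflection]
      rfl

/-- The base angle `β` of the triangle is `arctan c`. -/
theorem exp_angle : Complex.exp (2 * (EuclideanGeometry.angle C A B : ℝ) * Complex.I) =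
    apexRotation c := by
  have hc := hN.c_pos
  set β := EuclideanGeometry.angle C A B with hβ
  have hsub : ∀ p q : ℂ, Λ (p - q) = normMap A B Λ p - normMap A B Λ q := by
    intro p q
    rw [normMap_apply, normMap_apply, ← map_sub, sub_sub_sub_cancel_right]
  have hcos : Real.cos β = 1 / Real.sqrt (1 + c ^ 2) := by
    rw [hβ, EuclideanGeometry.angle, InnerProductGeometry.cos_angle, vsub_eq_sub, vsub_eq_sub]
    have hk := hN.k_pos
    have hnorm : ∀ u : ℂ, ‖u‖ = ‖Λ u‖ / Real.sqrt k := by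
      intro u
      rw [eq_div_iff (Real.sqrt_pos.2 hk).ne', ← pow_left_inj₀ (by positivity) (norm_nonneg _)
        two_ne_zero, mul_pow, Real.sq_sqrt hk.le, hN.norm_sq, mul_comm]
    have hin : ∀ u w : ℂ, inner ℝ u w = inner ℝ (Λ u) (Λ w) / k := by
      intro u w
      rw [hN.inner_map, mul_div_cancel_left₀ _ hk.ne']
    rw [hnorm (C - A), hnorm (B - A), hin, hsub, hsub, hN.normMap_A, hN.normMap_B, hN.normMap_C]
    have h1 : ‖(c : ℂ) * Complex.I - -1‖ = Real.sqrt (1 + c ^ 2) := by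
      rw [Complex.norm_def, Complex.normSq_apply]
      congr 1
      simp
      ring
    have h2 : ‖(1 : ℂ) - -1‖ = 2 := by norm_num
    have h3 : inner ℝ ((c : ℂ) * Complex.I - -1) ((1 : ℂ) - -1) = (2 : ℝ) := by
      simp [Complex.inner]
      norm_num
    rw [h1, h2, h3]
    have h4 : 0 < Real.sqrt (1 + c ^ 2) := Real.sqrt_pos.2 (by positivity)
    have h5 : Real.sqrt k ^ 2 = k := Real.sq_sqrt hk.le
    have h6 : 0 < Real.sqrt k := Real.sqrt_pos.2 hk
    field_simp
    rw [h5]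
  have hs : Real.sqrt (1 + c ^ 2) ^ 2 = 1 + c ^ 2 := Real.sq_sqrt (by positivity)
  have hs0 : 0 < Real.sqrt (1 + c ^ 2) := Real.sqrt_pos.2 (by positivity)
  have hsin : Real.sin β = c / Real.sqrt (1 + c ^ 2) := by
    have h0 : 0 ≤ Real.sin β := InnerProductGeometry.sin_angle_nonneg _ _
    rw [← pow_left_inj₀ h0 (by positivity) two_ne_zero, Real.sin_sq, hcos]
    field_simp
    rw [hs]
    ring
  have h2 : (2 : ℂ) * (β : ℂ) = ((2 * β : ℝ) : ℂ) := by push_cast; rfl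
  rw [h2, Complex.exp_mul_I, ← Complex.ofReal_cos, ← Complex.ofReal_sin, Real.cos_two_mul,
    Real.sin_two_mul, hcos, hsin]
  apply Complex.ext
  · simp only [Complex.add_re, Complex.ofReal_re, Complex.re_ofReal_mul, Complex.I_re, mul_zero,
      add_zero, apexRotation, div_pow, hs]
    field_simp
    ring
  · have h3 : 2 * (c / √(1 + c ^ 2)) * (1 / √(1 + c ^ 2)) = 2 * c / (1 + c ^ 2) := by
      nth_rewrite 3 [← hs]
      field_simp
    simp only [Complex.add_im, Complex.ofReal_im, Complex.im_ofReal_mul, Complex.I_im, mul_one,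
      zero_add, apexRotation, h3]

end IsNormalisation

/-! ### Words -/

/-- The edge of the isosceles triangle that is struck when the folded trajectory strikes the edge
`x ≠ 2` of the half triangle, if the trajectory is on the side of `B` (`s = true`) or of `A`. -/
def unfoldLetter (s : Bool) (x : Fin 3) : Fin 3 := if x = 1 then (if s then 1 else 2) else 0

/-- The word in the edges of the isosceles triangle of a trajectory that starts on the side `s` and whose
folded trajectory has the given word: a letter `2` records a passage to the other side. -/
def unfoldWord : Bool → List (Fin 3) → List (Fin 3)
  | _, [] => []
  | s, x :: l => if x = 2 then unfoldWord (!s) l else unfoldLetter s x :: unfoldWord s l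

/-- The side on which a trajectory ends that starts on the side `s` and whose folded trajectory has the
given word. -/
def endSide : Bool → List (Fin 3) → Bool
  | s, [] => s
  | s, x :: l => endSide (if x = 2 then !s else s) l

theorem endSide_append (s : Bool) (l l' : List (Fin 3)) :
    endSide s (l ++ l') = endSide (endSide s l) l' := by
  induction l generalizing s with
  | nil => rfl
  | cons x l ih => simp only [List.cons_append, endSide, ih]

theorem endSide_not (s : Bool) (l : List (Fin 3)) : endSide (!s) l = !endSide s l := by
  induction l generalizing s with
  | nil => rfl
  | cons x l ih => by_cases hx : x = 2 <;> simp [endSide, hx, ih]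

theorem unfoldWord_append (s : Bool) (l l' : List (Fin 3)) :
    unfoldWord s (l ++ l') = unfoldWord s l ++ unfoldWord (endSide s l) l' := by
  induction l generalizing s with
  | nil => rfl
  | cons x l ih => by_cases hx : x = 2 <;> simp [unfoldWord, endSide, hx, ih]

/-- The mirror image of a trajectory starts on the other side and strikes the other leg. -/
theorem unfoldWord_not (s : Bool) (l : List (Fin 3)) :
    unfoldWord (!s) l = (unfoldWord s l).map swapLegs := by
  have hletter : ∀ s x, unfoldLetter (!s) x = swapLegs (unfoldLetter s x) := by decide
  have hswap : swapLegs ∘ swapLegs = id := by decide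
  induction l generalizing s with
  | nil => rfl
  | cons x l ih => by_cases hx : x = 2 <;> simp [unfoldWord, hx, ih, hletter, hswap]

theorem endSide_reverse (s : Bool) (l : List (Fin 3)) : endSide s l.reverse = endSide s l := by
  induction l generalizing s with
  | nil => rfl
  | cons x l ih => by_cases hx : x = 2 <;> simp [endSide_append, endSide, hx, ih, endSide_not]

theorem unfoldWord_reverse (s : Bool) (l : List (Fin 3)) :
    unfoldWord s l.reverse = (unfoldWord (endSide s l) l).reverse := by
  induction l generalizing s with
  | nil => rfl
  | cons x l ih =>
    by_cases hx : x = 2 <;>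
      simp [unfoldWord_append, unfoldWord, endSide, hx, ih, endSide_not, endSide_reverse]

/-- Words of a folded closed trajectory that are equal up to the starting point unfold to words that are
equal up to the starting point, for a suitable choice of the starting sides. -/
theorem unfoldWord_isRotated {w w' : List (Fin 3)} (h : w.IsRotated w') {s : Bool}
    (hs : endSide s w = s) : ∃ s', (unfoldWord s w).IsRotated (unfoldWord s' w') := by
  obtain ⟨n, rfl⟩ := h
  rw [List.rotate_eq_drop_append_take_mod]
  have hw := List.take_append_drop (n % w.length) w
  generalize w.take (n % w.length) = u at *
  generalize w.drop (n % w.length) = v at *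
  subst hw
  rw [endSide_append] at hs
  exact ⟨endSide s u, by rw [unfoldWord_append, unfoldWord_append, hs]; exact List.isRotated_append⟩

/-- The part of the sequence of letters that records edges of the isosceles triangle. -/
theorem unfoldWord_map_range {y : ℕ → Fin 3} {s : ℕ → Bool}
    (hs : ∀ i, s (i + 1) = if y i = 2 then !s i else s i) (n : ℕ) :
    endSide (s 0) ((List.range n).map y) = s n ∧
    unfoldWord (s 0) ((List.range n).map y) =
      ((List.range n).filter (fun i => y i ≠ 2)).map (fun i => unfoldLetter (s i) (y i)) := by
  induction n with
  | zero => exact ⟨rfl, rfl⟩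
  | succ n ih =>
    rw [List.range_succ, List.map_append, endSide_append, unfoldWord_append, ih.1, ih.2,
      List.filter_append, List.map_append]
    by_cases hx : y n = 2 <;> simp [unfoldWord, endSide, hs, hx]

theorem map_range_shift_isRotated {α : Type*} {y : ℤ → α} {n : ℕ} (hy : ∀ i, y (i + n) = y i)
    (q : ℤ) :
    ((List.range n).map fun i : ℕ => y (i + q)).IsRotated ((List.range n).map fun i : ℕ => y i) := by
  rcases n.eq_zero_or_pos with rfl | hn
  · simp
  have hmod : ∀ i : ℤ, y (i % n) = y i := by
    intro i
    have h1 : Function.Periodic y (n : ℤ) := hy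
    have h2 := h1.int_mul (i / n) (i % n)
    rw [← h2]
    congr 1
    have := Int.emod_add_mul_ediv i n
    simp
    linarith
  refine List.IsRotated.symm ⟨(q % n).toNat, ?_⟩
  apply List.ext_getElem
  · simp
  · intro i h1 h2
    simp only [List.getElem_rotate, List.length_map, List.length_range, List.getElem_map,
      List.getElem_range]
    rw [← hmod (i + q)]
    congr 1
    have h3 := Int.emod_nonneg q (b := n) (by omega)
    push_cast
    rw [Int.toNat_of_nonneg h3, Int.add_emod_emod]

theorem map_range_reflect_isRotated {α : Type*} {y : ℤ → α} {n : ℕ} (hy : ∀ i, y (i + n) = y i)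
    (q : ℤ) :
    ((List.range n).map fun i : ℕ => y (q - i)).IsRotated
      ((List.range n).map fun i : ℕ => y i).reverse := by
  rw [← List.isRotated_reverse_comm_iff]
  have : ((List.range n).map fun i : ℕ => y (q - i)).reverse =
      (List.range n).map fun i : ℕ => y (i + (q - n + 1)) := by
    apply List.ext_getElem
    · simp
    · intro i h1 h2
      simp at h2
      simp
      congr 1
      omega
  rw [this]
  exact map_range_shift_isRotated hy _

/-- A word may be read off from any increasing sequence of times of which the hits of one period are a
sublist. -/
theorem hasCombinatorialType_map {v : Fin 3 → ℂ} {f : ℝ → ℂ} {L : ℝ} {T : ℕ → ℝ} (hT : StrictMono T)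
    {l : List ℕ} (hl : l.Pairwise (· < ·)) {e : ℕ → Fin 3}
    (hr : ∀ t, (∃ i ∈ l, T i = t) ↔ t ∈ Set.Ico 0 L ∧ ∃ i, f t ∈ edge v i)
    (he : ∀ i ∈ l, ∀ k, f (T i) ∈ edge v k ↔ k = e i) : HasCombinatorialType v f L (l.map e) := by
  have hlen : (l.map e).length = l.length := List.length_map _
  refine ⟨fun j => T (l.get (j.cast hlen)), ?_, ?_, ?_⟩
  · intro i j hij
    exact hT (List.pairwise_iff_get.1 hl _ _ hij)
  · ext t
    rw [Set.mem_ofPred_eq, ← hr]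
    constructor
    · rintro ⟨j, rfl⟩
      exact ⟨_, List.get_mem _ _, rfl⟩
    · rintro ⟨i, hi, rfl⟩
      obtain ⟨j, rfl⟩ := List.get_of_mem hi
      exact ⟨j.cast hlen.symm, rfl⟩
  · intro j k
    rw [he _ (List.get_mem _ _)]
    simp

/-! ### Unfolding a trajectory of the half triangle -/

/-- The point is carried by the folding of the triangle `-1`, `1`, `c i` to the `i`-th edge of the half
triangle `0`, `1`, `c i`. -/
def OnHalfEdge (c : ℝ) (i : Fin 3) (z : ℂ) : Prop :=
  ![z.im = 0, height c 1 z = 0 ∨ height c 2 z = 0, z.re = 0] i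

namespace IsStdTrajectory

variable {c : ℝ} {ζ : ℂ} {F : ℝ → ℂ} {L : ℝ} (hF : IsStdTrajectory c ζ F L)

include hF

/-- The side `s i` of the axis on which a trajectory arrives at the `i`-th hit of the half triangle.
It changes exactly at the hits of the altitude, and selects the leg among the two that are folded
together. -/
theorem exists_side (hc : 0 < c) (hζ : ‖ζ‖ = 1) {n : ℕ} {T : ℤ → ℝ}
    (hT : StrictMono T) (hTr : Set.range T = {t | ∃ i, OnHalfEdge c i (F t)})
    (hTn : ∀ i, T (i + n) = T i + L) {y : ℤ → Fin 3}
    (hy : ∀ j k, OnHalfEdge c k (F (T j)) ↔ k = y j) :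
    ∃ s : ℤ → Bool, (∀ i, s (i + 1) = if y i = 2 then !s i else s i) ∧ (∀ i, s (i + n) = s i) ∧
      ∀ i, y i ≠ 2 → ∀ k, height c k (F (T i)) = 0 ↔ k = unfoldLetter (s i) (y i) := by
  have hcont : Continuous fun t => (F t).re := Complex.continuous_re.comp (hF.continuous hζ)
  have hlt : ∀ i, T i < T (i + 1) := fun i => hT (by omega)
  have hlt' : ∀ i, T (i - 1) < T i := fun i => hT (by omega)
  have hno : ∀ i, ∀ t ∈ Set.Ioo (T i) (T (i + 1)), (F t).re ≠ 0 := by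
    intro i t ht h
    have : t ∈ Set.range T := by rw [hTr]; exact ⟨2, h⟩
    obtain ⟨j, rfl⟩ := this
    have h1 := hT.lt_iff_lt.1 ht.1
    have h2 := hT.lt_iff_lt.1 ht.2
    omega
  -- The sign of the abscissa is constant where the axis is not met.
  have hsign : ∀ a b, a ≤ b → (∀ t ∈ Set.Icc a b, (F t).re ≠ 0) →
      (0 < (F a).re ↔ 0 < (F b).re) := by
    intro a b hab h
    by_contra hne
    have ha := h a ⟨le_rfl, hab⟩
    have hb := h b ⟨hab, le_rfl⟩
    rcases lt_or_gt_of_ne ha with ha | ha <;> rcases lt_or_gt_of_ne hb with hb | hb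
    · exact hne (by constructor <;> intro <;> linarith)
    · obtain ⟨t, ht, h0⟩ := intermediate_value_Icc hab hcont.continuousOn ⟨ha.le, hb.le⟩
      exact h t ht h0
    · obtain ⟨t, ht, h0⟩ := intermediate_value_Icc' hab hcont.continuousOn ⟨hb.le, ha.le⟩
      exact h t ht h0
    · exact hne (by constructor <;> intro <;> assumption)
  set mid : ℤ → ℝ := fun i => (T (i - 1) + T i) / 2 with hmid
  have hmid1 : ∀ i, T (i - 1) < mid i := fun i => by simp only [hmid]; linarith [hlt' i]
  have hmid2 : ∀ i, mid i < T i := fun i => by simp only [hmid]; linarith [hlt' i]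
  have hno1 : ∀ i t, T (i - 1) < t → t < T i → (F t).re ≠ 0 := fun i t h1 h2 =>
    hno (i - 1) t ⟨h1, by rwa [sub_add_cancel]⟩
  have hno2 : ∀ i t, T i < t → t < T (i + 1) → (F t).re ≠ 0 := fun i t h1 h2 => hno i t ⟨h1, h2⟩
  have hmid3 : ∀ i, T i < mid (i + 1) := fun i => by
    have := hmid1 (i + 1)
    rwa [add_sub_cancel_right] at this
  have haxis : ∀ i, (F (T i)).re = 0 ↔ y i = 2 := fun i => by
    rw [eq_comm (a := y i), ← hy i 2]; rfl
  classical
  refine ⟨fun i => decide (0 < (F (mid i)).re), fun i => ?_, fun i => ?_, fun i hi => ?_⟩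
  · split_ifs with h
    · have hre : (F (T i)).re = 0 := (haxis i).2 h
      have hoff : ∀ k, height c k (F (T i)) ≠ 0 := by
        intro k hk
        have h0 : ¬ OnHalfEdge c 0 (F (T i)) := by rw [hy, h]; decide
        have h1 : ¬ OnHalfEdge c 1 (F (T i)) := by rw [hy, h]; decide
        fin_cases k
        · exact h0 hk
        · exact h1 (Or.inl hk)
        · exact h1 (Or.inr hk)
      obtain ⟨u, hu, hs⟩ := hF.straight _ hoff
      have hs' : ∀ᶠ t in nhds (T i), (F t).re = (t - T i) * u.re := by
        filter_upwards [hs] with t ht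
        rw [ht, Complex.add_re, hre, zero_add, Complex.smul_re, smul_eq_mul]
      obtain ⟨ε, hε, hball⟩ := Metric.eventually_nhds_iff_ball.1 hs'
      obtain ⟨a, ha1, ha2⟩ := exists_between (max_lt (sub_lt_self (T i) hε) (hmid2 i))
      obtain ⟨b, hb1, hb2⟩ := exists_between (lt_min (lt_add_of_pos_right (T i) hε) (hmid3 i))
      have ha3 := (le_max_left _ _).trans_lt ha1
      have ha4 := (le_max_right _ _).trans_lt ha1
      have hb3 := hb2.trans_le (min_le_left _ _)
      have hb4 := hb2.trans_le (min_le_right _ _)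
      have hFa := hball a (by rw [Metric.mem_ball, Real.dist_eq, abs_lt]; constructor <;> linarith)
      have hFb := hball b (by rw [Metric.mem_ball, Real.dist_eq, abs_lt]; constructor <;> linarith)
      have h1 := hsign (mid i) a ha4.le fun t ht =>
        hno1 i t ((hmid1 i).trans_le ht.1) (ht.2.trans_lt ha2)
      have h2 := hsign b (mid (i + 1)) hb4.le fun t ht =>
        hno2 i t (hb1.trans_le ht.1) (ht.2.trans_lt (hmid2 (i + 1)))
      have hane := hno1 i a ((hmid1 i).trans ha4) ha2
      rw [hFa] at hane h1
      rw [hFb] at h2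
      have hure : u.re ≠ 0 := right_ne_zero_of_mul hane
      have h3 : a - T i < 0 := by linarith
      have h4 : 0 < b - T i := by linarith
      rw [decide_not.symm, decide_eq_decide, h1, ← h2]
      rcases lt_or_gt_of_ne hure with h5 | h5
      · simp only [mul_pos_of_neg_of_neg h3 h5, (mul_neg_of_pos_of_neg h4 h5).not_gt, not_true_eq_false]
      · simp only [mul_pos h4 h5, (mul_neg_of_neg_of_pos h3 h5).not_gt, not_false_eq_true]
    · rw [decide_eq_decide]
      refine (hsign _ _ ((hmid2 i).trans (hmid3 i)).le fun t ht => ?_).symm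
      rcases lt_trichotomy t (T i) with h1 | rfl | h1
      · exact hno1 i t ((hmid1 i).trans_le ht.1) h1
      · rwa [Ne, haxis]
      · exact hno2 i t h1 (ht.2.trans_lt (hmid2 (i + 1)))
  · have : mid (i + n) = mid i + L := by
      simp only [hmid]
      rw [hTn, show i + (n : ℤ) - 1 = i - 1 + n by ring, hTn]
      ring
    simp only [this, hF.periodic (mid i)]
  · have hre : (F (T i)).re ≠ 0 := by rwa [Ne, haxis]
    have h1 := hsign _ _ (hmid2 i).le fun t ht => by
      rcases ht.2.lt_or_eq with h1 | rfl
      · exact hno1 i t ((hmid1 i).trans_le ht.1) h1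
      · exact hre
    intro k
    simp only [h1]
    have hk0 := hy i 0
    have hk1 := hy i 1
    have hn1 := hF.nonneg (T i) 1
    have hn2 := hF.nonneg (T i) 2
    clear h1
    generalize F (T i) = w at *
    generalize y i = x at *
    simp only [OnHalfEdge, Matrix.cons_val_zero, Matrix.cons_val_one] at hk0 hk1
    have hpos : 0 < w.re → height c 2 w ≠ 0 := by
      intro h
      simp [height] at hn1 ⊢
      nlinarith
    have hneg : ¬ 0 < w.re → height c 1 w ≠ 0 := by
      intro h
      have : w.re < 0 := lt_of_le_of_ne (not_lt.1 h) hre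
      simp [height] at hn2 ⊢
      nlinarith
    have hh0 : height c 0 w = 0 ↔ w.im = 0 := by simp [height]
    rw [← hh0] at hk0
    have hx : x = 0 ∨ x = 1 := by
      revert hi
      clear * -
      revert x
      decide
    have hk : k = 0 ∨ k = 1 ∨ k = 2 := by
      clear * -
      revert k
      decide
    rcases hx with rfl | rfl
    · rcases hk with rfl | rfl | rfl <;> simp at hk0 hk1 <;> simp [unfoldLetter, hk0, hk1]
    · simp only [Fin.isValue, zero_ne_one, iff_false, iff_true] at hk0 hk1
      by_cases hp : 0 < w.re
      · have h2 := hpos hp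
        have h1 := hk1.resolve_right h2
        rcases hk with rfl | rfl | rfl <;> simp [unfoldLetter, hp, hk0, h1, h2]
      · have h1 := hneg hp
        have h2 := hk1.resolve_left h1
        rcases hk with rfl | rfl | rfl <;> simp [unfoldLetter, hp, hk0, h1, h2]

end IsStdTrajectory

/-! ### Combinatorial types of a trajectory and of the folded trajectory -/

namespace IsNormalisation

variable {A B C : ℂ} {Λ : ℂ →ₗ[ℝ] ℂ} {c k : ℝ} (hN : IsNormalisation A B C Λ c k)

include hN

theorem mem_edge_fold_iff {z : ℂ} (hz : z ∈ convexHull ℝ (Set.range (triangleT A B C))) (i : Fin 3) :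
    fold A B z ∈ edge (triangleT' A B C) i ↔ OnHalfEdge c i (normMap A B Λ z) := by
  fin_cases i
  · exact hN.mem_edge_fold_zero hz
  · exact hN.mem_edge_fold_one hz
  · exact hN.mem_edge_fold_two hz

/-- The word of a trajectory is unfolded from the word of the folded trajectory; since the trajectory
returns to the side on which it starts, the axis is crossed an even number of times. -/
theorem exists_unfoldWord {f : ℝ → ℂ} {L : ℝ} (hf : IsPeriodicTrajectory (triangleT A B C) f L)
    {w : List (Fin 3)} (hw : HasCombinatorialType (triangleT' A B C) (fold A B ∘ f) L w) :
    ∃ s, endSide s w = s ∧ HasCombinatorialType (triangleT A B C) f L (unfoldWord s w) ∧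
      ∀ t, normMap A B Λ (f t) ≠ 0 := by
  have hc := hN.c_pos
  have hζ := norm_apexRotation c
  have hF := hN.isStdTrajectory hf
  set F : ℝ → ℂ := normMap A B Λ ∘ f with hFdef
  obtain ⟨τ, hτ, hτr, hτe⟩ := hw
  have hmem : ∀ t i, (fold A B ∘ f) t ∈ edge (triangleT' A B C) i ↔ OnHalfEdge c i (F t) :=
    fun t i => hN.mem_edge_fold_iff (hf.mem t) i
  simp only [hmem] at hτr hτe
  have hhit : ∀ t i, f t ∈ edge (triangleT A B C) i ↔ height c i (F t) = 0 :=
    fun t i => hN.mem_edge_iff (hf.mem t) i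
  have hhalf : ∀ z i, height c i z = 0 → ∃ j, j ≠ 2 ∧ OnHalfEdge c j z := by
    intro z i hi
    fin_cases i
    · exact ⟨0, by decide, hi⟩
    · exact ⟨1, by decide, Or.inl hi⟩
    · exact ⟨1, by decide, Or.inr hi⟩
  have hn : 0 < w.length := by
    obtain ⟨t, ht, i, hi⟩ := hF.exists_hit hζ
    obtain ⟨j, -, hj⟩ := hhalf _ _ hi
    have : t ∈ Set.range τ := by rw [hτr]; exact ⟨ht, j, hj⟩
    obtain ⟨l, -⟩ := this
    exact Fin.pos l
  obtain ⟨T, hT, hTr, hTn, hTτ⟩ := exists_enumeration hF.pos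
    (s := {t | ∃ i, OnHalfEdge c i (F t)})
    (fun t => by simp only [Set.mem_ofPred_eq, hF.periodic t]) hn τ hτ hτr
  -- Every hit is a translate of one of the hits of the first period.
  have hmod : ∀ i : ℤ, ∃ j : Fin w.length, F (T i) = F (τ j) := by
    intro i
    have hmem : T i ∈ {t | ∃ i, OnHalfEdge c i (F t)} := hTr ▸ ⟨i, rfl⟩
    obtain ⟨j, hj⟩ := hmem
    have h1 : toIcoMod hF.pos 0 (T i) ∈ Set.range τ := by
      rw [hτr]
      refine ⟨by simpa using toIcoMod_mem_Ico hF.pos 0 (T i), j, ?_⟩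
      rwa [← self_sub_toIcoDiv_zsmul, zsmul_eq_mul, hF.periodic.sub_int_mul_eq]
    obtain ⟨l, hl⟩ := h1
    refine ⟨l, ?_⟩
    rw [hl, ← self_sub_toIcoDiv_zsmul, zsmul_eq_mul, hF.periodic.sub_int_mul_eq]
  choose m hm using hmod
  obtain ⟨s, hs1, hs2, hs3⟩ := hF.exists_side hc hζ hT hTr hTn (y := fun i => w.get (m i))
    (fun j k => by rw [hm, hτe])
  have hyw : ∀ i : Fin w.length, w.get (m (i : ℕ)) = w.get i := by
    intro i
    have h1 := (hτe (m (i : ℕ)) (w.get i)).1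
    rw [← hm, hTτ] at h1
    exact (h1 ((hτe i _).2 rfl)).symm
  have hwlist : w = (List.range w.length).map fun i : ℕ => w.get (m i) := by
    apply List.ext_getElem
    · simp
    · intro i h1 h2
      simpa using (hyw ⟨i, h1⟩).symm
  obtain ⟨hend, hunf⟩ := unfoldWord_map_range (y := fun i : ℕ => w.get (m i)) (s := fun i : ℕ => s i)
    (fun i => by simpa using hs1 i) w.length
  rw [← hwlist] at hend hunf
  refine ⟨s 0, ?_, ?_, ?_⟩
  · rw [Nat.cast_zero] at hend
    rw [hend]
    simpa using hs2 0
  · rw [Nat.cast_zero] at hunf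
    rw [hunf]
    refine hasCombinatorialType_map (T := fun i : ℕ => T i) (fun i j hij => hT (by exact_mod_cast hij))
      (List.Pairwise.filter _ List.pairwise_lt_range) ?_ ?_
    · intro t
      simp only [List.mem_filter, List.mem_range, decide_eq_true_eq, hhit]
      constructor
      · rintro ⟨i, ⟨hi, hi2⟩, rfl⟩
        have h1 : T i ∈ Set.range τ := ⟨⟨i, hi⟩, (hTτ ⟨i, hi⟩).symm⟩
        rw [hτr] at h1
        exact ⟨h1.1, _, (hs3 i hi2 _).2 rfl⟩
      · rintro ⟨ht, k, hk⟩
        obtain ⟨j, hj, hj'⟩ := hhalf _ _ hk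
        have h1 : t ∈ Set.range τ := by rw [hτr]; exact ⟨ht, j, hj'⟩
        obtain ⟨i, rfl⟩ := h1
        refine ⟨i, ⟨i.2, ?_⟩, hTτ i⟩
        rw [hyw, ← (hτe i j).1 hj']
        exact hj
    · intro i hi k
      simp only [List.mem_filter, decide_eq_true_eq] at hi
      rw [hhit]
      exact hs3 i hi.2 k
  · intro t h0
    have h1 : t ∈ Set.range T := by
      rw [hTr]
      exact ⟨0, by simp [OnHalfEdge, hFdef, h0]⟩
    obtain ⟨i, rfl⟩ := h1
    have h2 : OnHalfEdge c 0 (F (T i)) := by simp [OnHalfEdge, hFdef, h0]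
    have h3 : OnHalfEdge c 2 (F (T i)) := by simp [OnHalfEdge, hFdef, h0]
    rw [hm, hτe] at h2 h3
    exact absurd (h2.trans h3.symm) (by decide)

/-- The combinatorial type of a trajectory that avoids the midpoint of the base is symmetric with respect
to the axis of the triangle. -/
theorem map_swapLegs_isRotated (hangle : AngleCondition (EuclideanGeometry.angle C A B))
    {f : ℝ → ℂ} {L : ℝ} (hf : IsPeriodicTrajectory (triangleT A B C) f L)
    {w : List (Fin 3)} (hw : HasCombinatorialType (triangleT A B C) f L w)
    (hM : ∀ t, normMap A B Λ (f t) ≠ 0) :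
    (w.map swapLegs).IsRotated w ∨ (w.map swapLegs).IsRotated w.reverse := by
  have hc := hN.c_pos
  have hζ := norm_apexRotation c
  have hF := hN.isStdTrajectory hf
  set F : ℝ → ℂ := normMap A B Λ ∘ f with hFdef
  obtain ⟨τ, hτ, hτr, hτe⟩ := hw
  have hhit : ∀ t i, f t ∈ edge (triangleT A B C) i ↔ height c i (F t) = 0 :=
    fun t i => hN.mem_edge_iff (hf.mem t) i
  simp only [hhit] at hτr hτe
  have hn : 0 < w.length := by
    obtain ⟨t, ht, i, hi⟩ := hF.exists_hit hζ
    have : t ∈ Set.range τ := by rw [hτr]; exact ⟨ht, i, hi⟩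
    obtain ⟨l, -⟩ := this
    exact Fin.pos l
  obtain ⟨T, hT, hTr, hTn, hTτ⟩ := exists_enumeration hF.pos
    (s := {t | ∃ i, height c i (F t) = 0}) (fun t => by simp only [Set.mem_ofPred_eq, hF.periodic t])
    hn τ hτ hτr
  have hex : ∀ i, ∃ j, height c j (F (T i)) = 0 := fun i => by
    have : T i ∈ {t | ∃ i, height c i (F t) = 0} := hTr ▸ ⟨i, rfl⟩
    exact this
  choose y hy using hex
  obtain ⟨H, hHn, hHy⟩ := hF.exists_hitSequence hζ hM hn hT hTr hTn hy
  have hwlist : w = (List.range w.length).map fun i : ℕ => y i := by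
    apply List.ext_getElem
    · simp
    · intro i h1 h2
      have h3 := hy i
      rw [hTτ ⟨i, h1⟩, hτe] at h3
      simp [h3]
  have hper : ∀ i, y (i + w.length) = y i := fun i => by rw [← hHy, ← hHn]; exact H.y_add i
  have hmap : w.map swapLegs = (List.range w.length).map fun i : ℕ => swapLegs (y i) := by
    conv_lhs => rw [hwlist, List.map_map]
    rfl
  obtain ⟨m, hm, hm'⟩ := hangle.exists_order
  rw [hN.exp_angle] at hm hm'
  rcases H.exists_symmetry hc hζ hm hm' with ⟨q, hq⟩ | ⟨q, hq⟩
  · right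
    rw [hHy] at hq
    simp only [hmap, ← hq]
    have := map_range_reflect_isRotated hper q
    rwa [← hwlist] at this
  · left
    rw [hHy] at hq
    simp only [hmap, ← hq]
    have := map_range_shift_isRotated hper q
    rwa [← hwlist] at this

end IsNormalisation

theorem theorem1p5 (A B C : ℂ)
    (hT : AffineIndependent ℝ ![A, B, C])
    (hiso : dist C A = dist C B)
    (hangle : AngleCondition (EuclideanGeometry.angle C A B))
    (f g : ℝ → ℂ) (L M : ℝ)
    (hf : IsPeriodicTrajectory (triangleT A B C) f L)
    (hg : IsPeriodicTrajectory (triangleT A B C) g M)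
    (hfg : SameCombinatorialType (triangleT' A B C) (fold A B ∘ f) L (fold A B ∘ g) M) :
    SameCombinatorialType (triangleT A B C) f L g M := by
  obtain ⟨Λ, c, k, hc, hk, hB, hC, hin⟩ := exists_similarity hT hiso
  have hN : IsNormalisation A B C Λ c k := ⟨hc, hk, hB, hC, hin⟩
  obtain ⟨w, w', hw, hw', hrot⟩ := hfg
  obtain ⟨s, hs, hws, -⟩ := hN.exists_unfoldWord hf hw
  obtain ⟨s', hs', hws', hM⟩ := hN.exists_unfoldWord hg hw'
  refine ⟨_, _, hws, hws', ?_⟩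
  -- The words of `f` and `g` agree for a suitable starting side of `g`.
  have key : ∃ r, (unfoldWord s w).IsRotated (unfoldWord r w') ∨
      (unfoldWord s w).IsRotated (unfoldWord r w').reverse := by
    rcases hrot with h | h
    · obtain ⟨r, hr⟩ := unfoldWord_isRotated h hs
      exact ⟨r, Or.inl hr⟩
    · obtain ⟨r, hr⟩ := unfoldWord_isRotated h hs
      rw [unfoldWord_reverse] at hr
      exact ⟨_, Or.inr hr⟩
  obtain ⟨r, hr⟩ := key
  -- The other starting side gives the mirror image of the word.
  have hsymm : (unfoldWord r w').IsRotated (unfoldWord s' w') ∨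
      (unfoldWord r w').IsRotated (unfoldWord s' w').reverse := by
    by_cases h : r = s'
    · rw [h]
      exact Or.inl (List.IsRotated.refl _)
    · rw [Bool.eq_not_iff.2 h, unfoldWord_not]
      exact hN.map_swapLegs_isRotated hangle hg hws' hM
  rcases hr with h1 | h1 <;> rcases hsymm with h2 | h2
  · exact Or.inl (h1.trans h2)
  · exact Or.inr (h1.trans h2)
  · exact Or.inr (h1.trans h2.reverse)
  · have := h1.trans h2.reverse
    rw [List.reverse_reverse] at this
    exact Or.inl this
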